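/- **Setting.** For a bit string $s=(a,b)\in\{0,1\}^{c_1}\times\{0,1\}^{c_2}$ put $\mathcal Q(s)=\sum_{i=1}^{c_1}2^{i-1}a_i+\sum_{j=1}^{c_2}2^{-j}b_j$. Let $A,B\in[0,\infty)^{N\times K}$ have entries $A_{jk}=\mathcal Q(\alpha_{jk})$, $B_{jk}=\mathcal Q(\beta_{jk})$ with bit strings $\alpha_{jk},\beta_{jk}$ of $c=c_1+c_2$ bits. Quantum access to $A$ means that the unitary $|r\rangle|x\rangle\mapsto|r\rangle|x\oplus \mathrm{vec}(\alpha)_r\rangle$ can be applied at the cost of one query, where $\mathrm{vec}(\alpha)$ is the vector of the $NK$ entries, column by column, and $r$ is a register of $\lceil\log_2(NK)\rceil$ qubits (basis states $r$ that name no entry are left fixed); likewise for $B$. A quantum algorithm works on finitely many qubits, initially $|0\cdots0\rangle$. It applies queries and gates and measures single qubits in the computational basis; its next steps may depend on the outcomes so far, every branch is finite, and it ends with a real number as output. The gates are all one-qubit unitaries, CNOT, Toffoli, and controlled rotations. A controlled rotation is determined by an arithmetic expression $p$ that is built by $+,-,\cdot,/$ from real constants and the values $\mathcal Q(u)$ of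 $c$-bit registers $u$ that do not contain the target qubit; it acts on the target by $|0\rangle\mapsto\sqrt{1-p}\,|0\rangle+\sqrt p\,|1\rangle$, $|1\rangle\mapsto-\sqrt p\,|0\rangle+\sqrt{1-p}\,|1\rangle$ on the basis states for which $p\in[0,1]$, and trivially on the others. Arithmetic is exact and has unit cost: a controlled rotation counts as $1$ gate plus $1$ for each arithmetic operation in $p$. All other gates, and also measurements, count as $1$ gate. **Theorem.** There are universal constants $C>0$ and $d\in\mathbb N$ such that the following holds for all $N,K\ge 1$, all $c_1,c_2$, all $\varepsilon,\delta\in(0,1)$ and all real $z_{\max}$. There is a quantum algorithm, depending only on $N,K,c_1,c_2,z_{\max},\varepsilon,\delta$, such that for all matrices $A,B$ as above with $\max_{j,k}A_{jk}B_{jk}=z_{\max}$, and with $t=\mathrm{tr}(A^{T}B)$, if the algorithm is run with quantum access to $A$ and $B$, then with probability at least $1-\delta$ all of the following hold: its output $I$ satisfies $$|I-t|\le\varepsilon\,t ,$$ it has used at most $C\,T$ queries, and it has used at most $C\,T\,\bigl(1+\log(NK(1+T))\bigr)^{d}$ gates, where $$T=\frac1\varepsilon\sqrt{\frac{NK\,z_{\max}}{t}}\;\max\Bigl\{1,\log\frac1\delta\Bigr\}\quad\text{if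 } t>0,\qquad T=0\quad\text{if } t=0 .$$ (So, as $\delta\to0$, the algorithm uses $O\bigl(\frac1\varepsilon\sqrt{NKz_{\max}/t}\,\log\frac1\delta\bigr)$ queries and $\tilde O$ of that many gates, where $\tilde O$ hides powers of the logarithms of $NK$ and of the query bound.) -/

import Mathlib

open scoped Matrix

namespace QuantumTrace

/-! ### Fixed-point numbers and vectorization -/

/-- Bit strings `(a, b)` with `c₁` integer bits and `c₂` fractional bits,
so `c = c₁ + c₂` bits in total. -/
abbrev FixedPoint (c₁ c₂ : ℕ) : Type := Fin c₁ ⊕ Fin c₂ → Bool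

/-- The number `a_{c₁} ⋯ a_1 . b_1 ⋯ b_{c₂}` encoded by a bit string (positions are counted
from `0` here: integer bit `i` has weight `2 ^ i`, fractional bit `j` has weight
`2 ^ (-(j + 1))`). -/
noncomputable def fixedPointValue {c₁ c₂ : ℕ} (s : FixedPoint c₁ c₂) : ℝ :=
  (∑ i : Fin c₁, if s (Sum.inl i) then (2 : ℝ) ^ (i : ℕ) else 0) +
    ∑ j : Fin c₂, if s (Sum.inr j) then (1 / 2 : ℝ) ^ ((j : ℕ) + 1) else 0

/-- The vector `vec(A)` that stacks the `K` columns of an `N × K` matrix: its entry with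
number `j + N * k` is the entry of `A` in row `j` and column `k`. -/
def stackColumns {N K : ℕ} {α : Type*} (A : Matrix (Fin N) (Fin K) α) : Fin (K * N) → α :=
  fun r => A.vec (finProdFinEquiv.symm r)

/-! ### States of `w` qubits -/

/-- A (not necessarily normalized) state vector of `w` qubits, by its amplitudes in the
computational basis. -/
abbrev State (w : ℕ) : Type := (Fin w → Bool) → ℂ

/-- The state `|0 ⋯ 0⟩`. -/
def zeroState (w : ℕ) : State w := fun x => if x = (fun _ => false) then 1 else 0

/-- The squared norm of a state vector. -/
noncomputable def State.weight {w : ℕ} (ψ : State w) : ℝ := ∑ x, ‖ψ x‖ ^ 2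

/-- The projection of `ψ` to the basis states whose qubit `i` has the value `b`: the
unnormalized state after a measurement of qubit `i` with outcome `b`. -/
def State.project {w : ℕ} (ψ : State w) (i : Fin w) (b : Bool) : State w :=
  fun x => if x i = b then ψ x else 0

/-- Apply to qubit `i` the `2 × 2` matrix `M x`, which may be controlled by the values `x` of
the other qubits. -/
def State.applyQubit {w : ℕ} (ψ : State w) (i : Fin w)
    (M : (Fin w → Bool) → Matrix Bool Bool ℂ) : State w :=
  fun x => ∑ b : Bool, M x (x i) b * ψ (Function.update x i b)

/-! ### Arithmetic on fixed-point registers, at unit cost per operation -/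

/-- Arithmetic expressions in the numbers held by fixed-point registers. A register is given by
the `c₁ + c₂` distinct qubits that hold its bits. -/
inductive ArithExpr (w c₁ c₂ : ℕ) : Type
  | const (r : ℝ)
  | reg (R : Fin c₁ ⊕ Fin c₂ ↪ Fin w)
  | add (e f : ArithExpr w c₁ c₂)
  | sub (e f : ArithExpr w c₁ c₂)
  | mul (e f : ArithExpr w c₁ c₂)
  | div (e f : ArithExpr w c₁ c₂)

namespace ArithExpr

variable {w c₁ c₂ : ℕ}

/-- The exact value of an expression on a basis state. -/
noncomputable def eval (x : Fin w → Bool) : ArithExpr w c₁ c₂ → ℝ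
  | const r => r
  | reg R => fixedPointValue fun p => x (R p)
  | add e f => eval x e + eval x f
  | sub e f => eval x e - eval x f
  | mul e f => eval x e * eval x f
  | div e f => eval x e / eval x f

/-- The number of arithmetic operations in an expression. -/
def numOps : ArithExpr w c₁ c₂ → ℕ
  | const _ => 0
  | reg _ => 0
  | add e f => numOps e + numOps f + 1
  | sub e f => numOps e + numOps f + 1
  | mul e f => numOps e + numOps f + 1
  | div e f => numOps e + numOps f + 1

/-- No register in the expression contains qubit `i`. -/
def Avoids (i : Fin w) : ArithExpr w c₁ c₂ → Prop
  | const _ => True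
  | reg R => ∀ p, R p ≠ i
  | add e f => Avoids i e ∧ Avoids i f
  | sub e f => Avoids i e ∧ Avoids i f
  | mul e f => Avoids i e ∧ Avoids i f
  | div e f => Avoids i e ∧ Avoids i f

end ArithExpr

/-! ### Quantum gates -/

/-- The rotation `|0⟩ ↦ √(1 - p) |0⟩ + √p |1⟩` for `p ∈ [0, 1]`, and the identity for other `p`.
The index `false` stands for `|0⟩` and `true` for `|1⟩`. -/
noncomputable def rotationMatrix (p : ℝ) : Matrix Bool Bool ℂ := open Classical in
  if 0 ≤ p ∧ p ≤ 1 then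
    Matrix.of fun r s =>
      match r, s with
      | false, false => (Real.sqrt (1 - p) : ℂ)
      | false, true => -(Real.sqrt p : ℂ)
      | true, false => (Real.sqrt p : ℂ)
      | true, true => (Real.sqrt (1 - p) : ℂ)
  else 1

/-- Quantum gates: arbitrary one-qubit unitaries, `CNOT` (control `i`, target `j`), the Toffoli
gate (controls `i`, `j`, target `k`), and the rotation of a target qubit that is controlled by the
value of an arithmetic expression in fixed-point registers. -/
inductive Gate (w c₁ c₂ : ℕ) : Type
  | oneQubit (U : Matrix.unitaryGroup Bool ℂ) (i : Fin w)
  | cnot (i j : Fin w) (hij : i ≠ j)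
  | toffoli (i j k : Fin w) (hij : i ≠ j) (hik : i ≠ k) (hjk : j ≠ k)
  | rotation (e : ArithExpr w c₁ c₂) (i : Fin w) (he : e.Avoids i)

namespace Gate

variable {w c₁ c₂ : ℕ}

/-- The action of a gate on a state. `CNOT` and Toffoli permute the basis states by an involution
`f`, so they send `ψ` to `ψ ∘ f`. -/
noncomputable def apply (ψ : State w) : Gate w c₁ c₂ → State w
  | oneQubit U i => ψ.applyQubit i fun _ => U.1
  | cnot i j _ => fun x => ψ (Function.update x j (xor (x j) (x i)))
  | toffoli i j k _ _ _ => fun x => ψ (Function.update x k (xor (x k) (x i && x j)))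
  | rotation e i _ => ψ.applyQubit i fun x => rotationMatrix (e.eval x)

/-- The cost of a gate: one, and one more for every arithmetic operation. -/
def cost : Gate w c₁ c₂ → ℕ
  | oneQubit _ _ => 1
  | cnot _ _ _ => 1
  | toffoli _ _ _ _ _ _ => 1
  | rotation e _ _ => e.numOps + 1

end Gate

/-! ### Quantum query access -/

/-- The number whose binary digits are the bits of `s`, the least significant bit first. -/
def binaryValue {m : ℕ} (s : Fin m → Bool) : ℕ := ∑ i : Fin m, if s i then 2 ^ (i : ℕ) else 0

/-- The basis state `|j⟩|b⟩` becomes `|j⟩|b ⊕ u_j⟩`, where `j` is read in the qubits `idx` and `b`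
in the qubits `data`. All basis states with `j ≥ n`, which name no entry, stay fixed. -/
def queryBasis {w n c₁ c₂ : ℕ} (u : Fin n → FixedPoint c₁ c₂)
    (idx : Fin (Nat.clog 2 n) ↪ Fin w) (data : Fin c₁ ⊕ Fin c₂ ↪ Fin w)
    (x : Fin w → Bool) : Fin w → Bool :=
  if hj : binaryValue (fun i => x (idx i)) < n then
    fun q => xor (x q) (decide (∃ p, data p = q ∧ u ⟨binaryValue (fun i => x (idx i)), hj⟩ p = true))
  else x

/-! ### Quantum programs with two oracles -/

/-- Which of the two input vectors a query addresses. -/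
inductive Source : Type
  | first
  | second

/-- A quantum algorithm on `w` qubits with query access to two vectors of `n` fixed-point
numbers: a finite tree of gates, queries, and measurements of single qubits, where the
continuation may depend on all outcomes so far. Each branch ends with a real number as output. -/
inductive Program (w n c₁ c₂ : ℕ) : Type
  | output (I : ℝ)
  | gate (G : Gate w c₁ c₂) (next : Program w n c₁ c₂)
  | query (s : Source) (idx : Fin (Nat.clog 2 n) ↪ Fin w) (data : Fin c₁ ⊕ Fin c₂ ↪ Fin w)
      (disjoint : ∀ i p, idx i ≠ data p) (next : Program w n c₁ c₂)
  | measure (i : Fin w) (next : Bool → Program w n c₁ c₂)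

namespace Program

variable {w n c₁ c₂ : ℕ}

/-- Run a program from the unnormalized state `ψ`, after `q` queries and `g` gates have been
used. The result is the total weight of the branches whose output `I`, total number of queries and
total number of gates satisfy `E`. A measurement is counted as a gate. The query permutes the
basis states by an involution. -/
noncomputable def weightFrom (u v : Fin n → FixedPoint c₁ c₂) (E : ℝ → ℕ → ℕ → Prop) :
    Program w n c₁ c₂ → State w → ℕ → ℕ → ℝ
  | output I, ψ, q, g => open Classical in if E I q g then ψ.weight else 0
  | gate G next, ψ, q, g => weightFrom u v E next (G.apply ψ) q (g + G.cost)
  | query Source.first idx data _ next, ψ, q, g =>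
      weightFrom u v E next (fun x => ψ (queryBasis u idx data x)) (q + 1) g
  | query Source.second idx data _ next, ψ, q, g =>
      weightFrom u v E next (fun x => ψ (queryBasis v idx data x)) (q + 1) g
  | measure i next, ψ, q, g =>
      ∑ b : Bool, weightFrom u v E (next b) (ψ.project i b) q (g + 1)

/-- The probability that the program, started in `|0 ⋯ 0⟩` with query access to `u` and `v`,
produces an output `I` with `q` queries and `g` gates such that `E I q g` holds. -/
noncomputable def prob (P : Program w n c₁ c₂) (u v : Fin n → FixedPoint c₁ c₂)
    (E : ℝ → ℕ → ℕ → Prop) : ℝ :=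
  weightFrom u v E P (zeroState w) 0 0

end Program

/-- The quantity `(1/ε) √(N K z / t) log(1/δ)`, where the logarithm is replaced by `1` if it is
less than `1`. If `z = t = 0`, this is `0`. -/
noncomputable def traceCost (N K : ℕ) (z t ε δ : ℝ) : ℝ :=
  1 / ε * Real.sqrt (N * K * z / t) * max 1 (Real.log (1 / δ))

end QuantumTrace

/-! Put the index register (`m` qubits, `n ≤ 2 ^ m ≤ 2 * n` with `n = K * N`) into uniform
superposition, load both entries, rotate a flag to `1` with probability (product of the entries) /
`(4096 * z)`, and unload. The flag is then `1` with probability `sin θ ^ 2 = t / (4096 * z * 2 ^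
m)`, so `t` is known up to a factor `1 ± ε` once `θ` is known up to a relative error of order `ε`.

After `k` steps of amplitude amplification the flag has probability `sin ((2 * k + 1) * θ) ^ 2`
(`Layout.grover_iterate`). Measuring it and resetting all live qubits yields an independent coin
with this bias for `4 * (2 * k + 1)` queries. `Layout.success_le_weightFrom_compile` thus reduces
the theorem to a classical one: estimate `θ` by adaptively chosen coins, coin `k` costing `2 * k +
1`, at total cost `O(log (1 / δ) / (ε * θ))`.

There is no phase estimation; `θ` is located by a ternary search. If `θ` lies in `[l, h]`, some coin
of cost `O(1 / (h - l))` is biased by at least `3 / 100`, in opposite directions on the lower and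
the upper third. A majority of `2 * R` such coins errs with probability at most `(399 / 400) ^ R`,
and on the middle third either answer is correct, so the interval shrinks by `2 / 3`
(`CoinTree.le_success_bisect`).

A careful distribution of the votes avoids additional logarithms. As long as the interval is `[0,
h]`, `R` stays fixed: for small `θ / h` the coin almost never shows heads, the error is `O(θ / h)`
times `(399 / 400) ^ R`, and errors as well as costs form geometric series
(`CoinTree.le_success_search`). Once `θ` is known up to a factor `3`, a step with `r` rounds to go
uses `R * r` in place of `R`: the expensive last rounds get the fewest votes, the errors are powers
of `(399 / 400) ^ R`, and the costs are summed by `∑ r * (2 / 3) ^ r < ∞`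
(`CoinTree.le_success_narrow`). Hence `R` of order `log (1 / δ)` suffices. -/

namespace QuantumTrace

/-! ### Linear algebra of states and weights of program runs -/

variable {w n c₁ c₂ : ℕ}

/-! ### Operators on a single qubit -/

theorem State.applyQubit_apply (ψ : State w) (i : Fin w) (M : (Fin w → Bool) → Matrix Bool Bool ℂ)
    (x : Fin w → Bool) :
    ψ.applyQubit i M x = M x (x i) true * ψ (Function.update x i true) +
      M x (x i) false * ψ (Function.update x i false) := by
  simp [State.applyQubit]

/-- `State.applyQubit` as a linear map. -/
def qubitMap (i : Fin w) (M : (Fin w → Bool) → Matrix Bool Bool ℂ) : State w →ₗ[ℂ] State w where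
  toFun ψ := ψ.applyQubit i M
  map_add' φ ψ := by
    ext x; simp only [State.applyQubit_apply, Pi.add_apply]; ring
  map_smul' c ψ := by
    ext x; simp only [State.applyQubit_apply, Pi.smul_apply, smul_eq_mul, RingHom.id_apply]; ring

theorem qubitMap_apply (i : Fin w) (M : (Fin w → Bool) → Matrix Bool Bool ℂ) (ψ : State w)
    (x : Fin w → Bool) :
    qubitMap i M ψ x = M x (x i) true * ψ (Function.update x i true) +
      M x (x i) false * ψ (Function.update x i false) :=
  ψ.applyQubit_apply i M x

/-- Only the inner matrix must be independent of the target qubit; the outer one is evaluated at `x`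
itself. -/
theorem qubitMap_comp (i : Fin w) (M M' : (Fin w → Bool) → Matrix Bool Bool ℂ)
    (hM : ∀ x b, M (Function.update x i b) = M x) (ψ : State w) :
    qubitMap i M' (qubitMap i M ψ) = qubitMap i (fun x => M' x * M x) ψ := by
  ext x
  simp only [qubitMap_apply, hM, Function.update_self, Function.update_idem, Matrix.mul_apply,
    Fintype.sum_bool]
  ring

theorem qubitMap_diagonal (i : Fin w) (M : (Fin w → Bool) → Matrix Bool Bool ℂ) (ψ : State w)
    (d : (Fin w → Bool) → Bool → ℂ) (hM : ∀ x, M x = Matrix.diagonal (d x)) (x : Fin w → Bool) :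
    qubitMap i M ψ x = d x (x i) * ψ x := by
  rw [qubitMap_apply, hM]
  cases h : x i
  · have : Function.update x i false = x := by rw [← h, Function.update_eq_self]
    simp [this]
  · have : Function.update x i true = x := by rw [← h, Function.update_eq_self]
    simp [this]

theorem qubitMap_one (i : Fin w) (M : (Fin w → Bool) → Matrix Bool Bool ℂ) (ψ : State w)
    (hM : ∀ x, M x = 1) : qubitMap i M ψ = ψ := by
  ext x
  rw [qubitMap_diagonal i M ψ (fun _ _ => 1) (fun x => by rw [hM]; exact Matrix.diagonal_one.symm),
    one_mul]

/-! ### The inner product -/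

/-- The inner product of two state vectors. -/
noncomputable def innerProd (φ ψ : State w) : ℂ := ∑ x, star (φ x) * ψ x

theorem innerProd_add_right (φ ψ χ : State w) :
    innerProd φ (ψ + χ) = innerProd φ ψ + innerProd φ χ := by
  simp [innerProd, mul_add, Finset.sum_add_distrib]

theorem innerProd_smul_right (c : ℂ) (φ ψ : State w) :
    innerProd φ (c • ψ) = c * innerProd φ ψ := by
  simp only [innerProd, Finset.mul_sum, Pi.smul_apply, smul_eq_mul]
  exact Finset.sum_congr rfl fun x _ => by ring

theorem innerProd_self (ψ : State w) : innerProd ψ ψ = (ψ.weight : ℂ) := by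
  simp only [innerProd, State.weight, Complex.ofReal_sum]
  refine Finset.sum_congr rfl fun x _ => ?_
  rw [Complex.star_def, Complex.conj_mul']
  norm_cast

theorem innerProd_zeroState (ψ : State w) : innerProd (zeroState w) ψ = ψ fun _ => false := by
  simp [innerProd, zeroState]

/-- Flipping qubit `i` is an involution, so each pair of states that differ there is counted twice.
This allows pairwise computations without splitting the index set. -/
theorem sum_update_add {α : Type*} [AddCommGroup α] (i : Fin w) (F : (Fin w → Bool) → α) :
    ∑ x, (F (Function.update x i true) + F (Function.update x i false)) =
      (∑ x, F x) + ∑ x, F x := by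
  have hinv : Function.Involutive fun x : Fin w → Bool => Function.update x i (!x i) := by
    intro x; simp
  have h : ∑ x, F x = ∑ x : Fin w → Bool, F (Function.update x i (!x i)) :=
    (Equiv.sum_comp hinv.toPerm F).symm
  conv_rhs => rw [h]
  rw [← h]
  nth_rewrite 2 [h]
  rw [← Finset.sum_add_distrib]
  refine Finset.sum_congr rfl fun x _ => ?_
  cases hx : x i
  · have : Function.update x i false = x := by rw [← hx, Function.update_eq_self]
    rw [this, add_comm]; rfl
  · have : Function.update x i true = x := by rw [← hx, Function.update_eq_self]
    rw [this]; rfl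

/-- Twice the inner product is a sum over pairs of basis states that differ at qubit `i`, and on
each pair the map is a `2 × 2` isometry. -/
theorem innerProd_qubitMap (i : Fin w) (M : (Fin w → Bool) → Matrix Bool Bool ℂ)
    (hM : ∀ x b, M (Function.update x i b) = M x) (hU : ∀ x, (M x)ᴴ * M x = 1) (φ ψ : State w) :
    innerProd (qubitMap i M φ) (qubitMap i M ψ) = innerProd φ ψ := by
  have key : innerProd (qubitMap i M φ) (qubitMap i M ψ) +
      innerProd (qubitMap i M φ) (qubitMap i M ψ) = innerProd φ ψ + innerProd φ ψ := by
    unfold innerProd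
    rw [← sum_update_add i, ← sum_update_add i]
    refine Finset.sum_congr rfl fun x _ => ?_
    have h11 := congrFun (congrFun (hU x) true) true
    have h10 := congrFun (congrFun (hU x) true) false
    have h01 := congrFun (congrFun (hU x) false) true
    have h00 := congrFun (congrFun (hU x) false) false
    simp only [Matrix.mul_apply, Matrix.conjTranspose_apply, Fintype.sum_bool, Matrix.one_apply,
      if_true, reduceCtorEq, if_false] at h11 h10 h01 h00
    simp only [qubitMap_apply, hM, Function.update_self, Function.update_idem, star_add, star_mul']
    linear_combination
      (star (φ (Function.update x i true)) * ψ (Function.update x i true)) * h11 +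
      (star (φ (Function.update x i true)) * ψ (Function.update x i false)) * h10 +
      (star (φ (Function.update x i false)) * ψ (Function.update x i true)) * h01 +
      (star (φ (Function.update x i false)) * ψ (Function.update x i false)) * h00
  have h2 : (2 : ℂ) * innerProd (qubitMap i M φ) (qubitMap i M ψ) = 2 * innerProd φ ψ := by
    rw [two_mul, two_mul, key]
  exact mul_left_cancel₀ two_ne_zero h2

theorem weight_qubitMap (i : Fin w) (M : (Fin w → Bool) → Matrix Bool Bool ℂ)
    (hM : ∀ x b, M (Function.update x i b) = M x) (hU : ∀ x, (M x)ᴴ * M x = 1) (ψ : State w) :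
    State.weight (qubitMap i M ψ) = ψ.weight := by
  have h := innerProd_qubitMap i M hM hU ψ ψ
  rw [innerProd_self, innerProd_self] at h
  exact_mod_cast h

theorem weight_smul (c : ℂ) (ψ : State w) : State.weight (c • ψ) = ‖c‖ ^ 2 * ψ.weight := by
  simp [State.weight, Finset.mul_sum, mul_pow]

theorem weight_nonneg (ψ : State w) : 0 ≤ ψ.weight := Finset.sum_nonneg fun _ _ => by positivity

theorem weight_zeroState : (zeroState w).weight = 1 := by
  simp [State.weight, zeroState, apply_ite]

theorem sum_weight_project (ψ : State w) (i : Fin w) :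
    ∑ b : Bool, (ψ.project i b).weight = ψ.weight := by
  simp only [State.weight, Fintype.sum_bool, ← Finset.sum_add_distrib]
  refine Finset.sum_congr rfl fun x _ => ?_
  cases h : x i <;> simp [State.project, h]

/-! ### States supported on a set of qubits -/

/-- In all basis states that occur in `ψ`, the qubits outside `S` are `0`. -/
def SupportedOn (S : Set (Fin w)) (ψ : State w) : Prop :=
  ∀ x q, q ∉ S → x q = true → ψ x = 0

theorem SupportedOn.add {S : Set (Fin w)} {φ ψ : State w} (hφ : SupportedOn S φ)
    (hψ : SupportedOn S ψ) : SupportedOn S (φ + ψ) := fun x q hq hx => by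
  rw [Pi.add_apply, hφ x q hq hx, hψ x q hq hx, add_zero]

theorem SupportedOn.smul {S : Set (Fin w)} {ψ : State w} (c : ℂ) (hψ : SupportedOn S ψ) :
    SupportedOn S (c • ψ) := fun x q hq hx => by
  rw [Pi.smul_apply, hψ x q hq hx, smul_zero]

theorem SupportedOn.qubitMap {S : Set (Fin w)} {ψ : State w} (hψ : SupportedOn S ψ) {i : Fin w}
    (hi : i ∈ S) (M : (Fin w → Bool) → Matrix Bool Bool ℂ) : SupportedOn S (qubitMap i M ψ) := by
  intro x q hq hx
  have hqi : q ≠ i := fun h => hq (h ▸ hi)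
  have h : ∀ b, ψ (Function.update x i b) = 0 := fun b =>
    hψ _ q hq (by rw [Function.update_of_ne hqi, hx])
  rw [qubitMap_apply, h, h, mul_zero, mul_zero, add_zero]

theorem SupportedOn.project {S : Set (Fin w)} {ψ : State w} (hψ : SupportedOn S ψ) (i : Fin w)
    (b : Bool) : SupportedOn S (ψ.project i b) := fun x q hq hx => by
  simp [State.project, hψ x q hq hx]

theorem supportedOn_zeroState (S : Set (Fin w)) : SupportedOn S (zeroState w) := by
  intro x q _ hx
  have : x ≠ fun _ => false := fun h => by simp [h] at hx
  simp [zeroState, this]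

theorem SupportedOn.eq_smul {ψ : State w} (hψ : SupportedOn ∅ ψ) :
    ψ = ψ (fun _ => false) • zeroState w := by
  ext x
  by_cases hx : x = fun _ => false
  · simp [hx, zeroState]
  · obtain ⟨q, hq⟩ := Function.ne_iff.1 hx
    simp only [ne_eq, Bool.not_eq_false] at hq
    simp [hψ x q (Set.notMem_empty q) hq, zeroState, hx]

/-! ### Weights of programs -/

/-- The one-qubit gate as a linear map. -/
theorem apply_oneQubit (U : Matrix.unitaryGroup Bool ℂ) (i : Fin w) (ψ : State w) :
    Gate.apply ψ (Gate.oneQubit U i : Gate w c₁ c₂) = qubitMap i (fun _ => U.1) ψ := rfl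

theorem apply_rotation (e : ArithExpr w c₁ c₂) (i : Fin w) (he : e.Avoids i) (ψ : State w) :
    Gate.apply ψ (Gate.rotation e i he) = qubitMap i (fun x => rotationMatrix (e.eval x)) ψ := rfl

theorem Gate.apply_smul (c : ℂ) (ψ : State w) (G : Gate w c₁ c₂) :
    G.apply (c • ψ) = c • G.apply ψ := by
  cases G with
  | oneQubit U i => rw [apply_oneQubit, apply_oneQubit, map_smul]
  | cnot i j h => rfl
  | toffoli i j k h h' h'' => rfl
  | rotation e i he => rw [apply_rotation, apply_rotation, map_smul]

/-- Runs are linear in the state and weights are quadratic. Pulling out the scalar lets a run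
restart from `zeroState` after a reset. -/
theorem weightFrom_smul (u v : Fin n → FixedPoint c₁ c₂) (E : ℝ → ℕ → ℕ → Prop)
    (P : Program w n c₁ c₂) (c : ℂ) (ψ : State w) (q g : ℕ) :
    P.weightFrom u v E (c • ψ) q g = ‖c‖ ^ 2 * P.weightFrom u v E ψ q g := by
  induction P generalizing ψ q g with
  | output I => simp only [Program.weightFrom, weight_smul]; split_ifs <;> simp
  | gate G next ih => simp only [Program.weightFrom, Gate.apply_smul, ih]
  | query s idx data hd next ih => cases s <;> exact ih _ _ _
  | measure i next ih =>
    have h : ∀ b, State.project (c • ψ) i b = c • ψ.project i b := fun b => by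
      ext x; simp [State.project]
    simp only [Program.weightFrom, h, ih, Finset.mul_sum]

/-- The program transformer `F` prepends steps that act on the state as `f`, with `a` queries and
`b` gates. -/
def Prepends (u v : Fin n → FixedPoint c₁ c₂) (F : Program w n c₁ c₂ → Program w n c₁ c₂)
    (f : State w → State w) (a b : ℕ) : Prop :=
  ∀ E P ψ q g, (F P).weightFrom u v E ψ q g = P.weightFrom u v E (f ψ) (q + a) (g + b)

theorem Prepends.comp {u v : Fin n → FixedPoint c₁ c₂} {F F' : Program w n c₁ c₂ → Program w n c₁ c₂}
    {f f' : State w → State w} {a b a' b' : ℕ} (h : Prepends u v F f a b)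
    (h' : Prepends u v F' f' a' b') :
    Prepends u v (fun P => F (F' P)) (fun ψ => f' (f ψ)) (a + a') (b + b') := fun E P ψ q g => by
  rw [h, h', add_assoc, add_assoc]

theorem Prepends.iterate {u v : Fin n → FixedPoint c₁ c₂} {F : Program w n c₁ c₂ → Program w n c₁ c₂}
    {f : State w → State w} {a b : ℕ} (h : Prepends u v F f a b) (k : ℕ) :
    Prepends u v F^[k] f^[k] (k * a) (k * b) := by
  induction k with
  | zero => intro E P ψ q g; simp
  | succ k ih =>
    have h2 := h.comp ih
    intro E P ψ q g
    rw [Function.iterate_succ_apply', Function.iterate_succ_apply, h2]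
    congr 1 <;> ring

/-! ### Resetting qubits -/

/-- The bit flip if `b` is `true`, the identity otherwise. -/
noncomputable def flipIf (b : Bool) : Matrix.unitaryGroup Bool ℂ :=
  ⟨Matrix.of fun r s => if xor r s = b then 1 else 0, by
    rw [Matrix.mem_unitaryGroup_iff']
    ext r s
    cases r <;> cases s <;> cases b <;> simp [Matrix.mul_apply]⟩

/-- Set all qubits of a list to `0`, by measurements and bit flips. -/
noncomputable def resetQubits : List (Fin w) → Program w n c₁ c₂ → Program w n c₁ c₂
  | [], P => P
  | i :: L, P => .measure i fun b => .gate (.oneQubit (flipIf b) i) (resetQubits L P)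

/-- Each branch ends in a multiple of the zero state, and the squared norms of the factors add up to
the weight of `ψ`. What follows is therefore independent of the past. The two gates per qubit are
the measurement and the flip. -/
theorem weightFrom_resetQubits (u v : Fin n → FixedPoint c₁ c₂) (E : ℝ → ℕ → ℕ → Prop)
    (L : List (Fin w)) (P : Program w n c₁ c₂) (ψ : State w) (hψ : SupportedOn {q | q ∈ L} ψ)
    (q g : ℕ) : (resetQubits L P).weightFrom u v E ψ q g =
      ψ.weight * P.weightFrom u v E (zeroState w) q (g + 2 * L.length) := by
  induction L generalizing ψ g with
  | nil =>
    have h := SupportedOn.eq_smul (ψ := ψ) (by simpa using hψ)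
    rw [h, weight_smul, weight_zeroState, weightFrom_smul]
    simp [resetQubits]
  | cons i L ih =>
    have hs : ∀ b, SupportedOn {q | q ∈ L}
        (qubitMap i (fun _ => (flipIf b).1) (ψ.project i b)) := by
      intro b x q hq hx
      rw [qubitMap_apply]
      by_cases hqi : q = i
      · subst hqi
        cases b <;> simp [flipIf, hx, State.project]
      · have h : ∀ b', ψ (Function.update x i b') = 0 := fun b' =>
          hψ _ q (by simpa [hqi] using hq) (by rw [Function.update_of_ne hqi, hx])
        simp [State.project, h]
    have hw : ∀ b, State.weight (qubitMap i (fun _ => (flipIf b).1) (ψ.project i b)) =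
        (ψ.project i b).weight := fun b =>
      weight_qubitMap i _ (fun _ _ => rfl)
        (fun _ => Matrix.mem_unitaryGroup_iff'.1 (flipIf b).2) _
    simp only [resetQubits, Program.weightFrom, apply_oneQubit, Gate.cost]
    simp only [ih _ (hs _), hw, ← Finset.sum_mul, sum_weight_project, List.length_cons]
    congr 2; ring

end QuantumTrace

/-! ### Gates, Hadamard layers and queries -/

namespace QuantumTrace

variable {w n c₁ c₂ : ℕ}

/-! ### The matrices that are used -/

/-- The Hadamard gate. -/
noncomputable def hadamard : Matrix.unitaryGroup Bool ℂ :=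
  ⟨Matrix.of fun r s => if r && s then -((Real.sqrt 2)⁻¹ : ℂ) else ((Real.sqrt 2)⁻¹ : ℂ), by
    have h : ((Real.sqrt 2)⁻¹ : ℂ) * ((Real.sqrt 2)⁻¹ : ℂ) = 1 / 2 := by
      rw [← Complex.ofReal_inv, ← Complex.ofReal_mul, ← mul_inv, Real.mul_self_sqrt (by norm_num)]
      norm_num
    rw [Matrix.mem_unitaryGroup_iff']
    ext r s
    cases r <;> cases s <;> simp [Matrix.mul_apply, h]
    norm_num⟩

theorem hadamard_mul_self : hadamard.1 * hadamard.1 = 1 := by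
  have h := Matrix.mem_unitaryGroup_iff'.1 hadamard.2
  rwa [show star hadamard.1 = hadamard.1 from ?_] at h
  ext r s
  rw [Matrix.star_apply]
  cases r <;> cases s <;> simp [hadamard]

/-- The phase flip `|1⟩ ↦ -|1⟩`. -/
noncomputable def phaseFlip : Matrix.unitaryGroup Bool ℂ :=
  ⟨Matrix.diagonal fun r => if r then -1 else 1, by
    rw [Matrix.mem_unitaryGroup_iff']
    ext r s
    cases r <;> cases s <;> simp [Matrix.mul_apply, Matrix.diagonal, Matrix.star_apply]⟩

theorem rotationMatrix_of_mem {p : ℝ} (h : 0 ≤ p ∧ p ≤ 1) (r s : Bool) :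
    rotationMatrix p r s = match r, s with
      | false, false => (Real.sqrt (1 - p) : ℂ)
      | false, true => -(Real.sqrt p : ℂ)
      | true, false => (Real.sqrt p : ℂ)
      | true, true => (Real.sqrt (1 - p) : ℂ) := by
  simp only [rotationMatrix, if_pos h]; rfl

theorem rotationMatrix_of_not_mem {p : ℝ} (h : ¬(0 ≤ p ∧ p ≤ 1)) : rotationMatrix p = 1 := by
  simp only [rotationMatrix, if_neg h]

theorem conjTranspose_mul_rotationMatrix (p : ℝ) : (rotationMatrix p)ᴴ * rotationMatrix p = 1 := by
  by_cases h : 0 ≤ p ∧ p ≤ 1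
  · have h1 : (Real.sqrt p : ℂ) * (Real.sqrt p : ℂ) = p := by
      rw [← Complex.ofReal_mul, Real.mul_self_sqrt h.1]
    have h2 : (Real.sqrt (1 - p) : ℂ) * (Real.sqrt (1 - p) : ℂ) = 1 - p := by
      rw [← Complex.ofReal_mul, Real.mul_self_sqrt (by linarith [h.2])]; simp
    ext r s
    cases r <;> cases s <;>
      simp [Matrix.mul_apply, rotationMatrix_of_mem h, h1, h2] <;> ring
  · simp [rotationMatrix_of_not_mem h]

theorem rotationMatrix_mul_conjTranspose (p : ℝ) : rotationMatrix p * (rotationMatrix p)ᴴ = 1 :=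
  mul_eq_one_comm.1 (conjTranspose_mul_rotationMatrix p)

/-- Conjugating a plane rotation by a reflection inverts it. This supplies inverse rotations, which
are not among the controlled gates. -/
theorem phaseFlip_mul_rotationMatrix_mul (p : ℝ) :
    phaseFlip.1 * (rotationMatrix p * phaseFlip.1) = (rotationMatrix p)ᴴ := by
  by_cases h : 0 ≤ p ∧ p ≤ 1
  · ext r s
    cases r <;> cases s <;>
      simp [phaseFlip, Matrix.mul_diagonal, Matrix.diagonal_mul,
        rotationMatrix_of_mem h]
  · rw [rotationMatrix_of_not_mem h, one_mul, Matrix.conjTranspose_one]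
    simp only [phaseFlip, Matrix.diagonal_mul_diagonal]
    rw [← Matrix.diagonal_one]
    congr 1
    ext r; cases r <;> simp

/-- At `p = 1` the gate is a quarter turn, and two of them are a sign. This is the source of the
phase in the reflection at the zero state. -/
theorem rotationMatrix_one_mul_self :
    rotationMatrix 1 * rotationMatrix 1 = Matrix.diagonal fun _ => (-1 : ℂ) := by
  have h : (0 : ℝ) ≤ 1 ∧ (1 : ℝ) ≤ 1 := by norm_num
  ext r s
  cases r <;> cases s <;> simp [Matrix.mul_apply, rotationMatrix_of_mem h]

/-! ### Hadamard gates on a list of qubits -/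

/-- Hadamard gates on the qubits of a list, the last one first. -/
noncomputable def hadamards : List (Fin w) → State w →ₗ[ℂ] State w
  | [] => LinearMap.id
  | i :: L => qubitMap i (fun _ => hadamard.1) ∘ₗ hadamards L

/-- Hadamard gates on the qubits of a list, the first one first. -/
noncomputable def hadamardsRev : List (Fin w) → State w →ₗ[ℂ] State w
  | [] => LinearMap.id
  | i :: L => hadamardsRev L ∘ₗ qubitMap i (fun _ => hadamard.1)

/-- The gates of `hadamards`. -/
noncomputable def hadamardGates : List (Fin w) → Program w n c₁ c₂ → Program w n c₁ c₂
  | [], P => P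
  | i :: L, P => hadamardGates L (.gate (.oneQubit hadamard i) P)

/-- The gates of `hadamardsRev`. -/
noncomputable def hadamardGatesRev : List (Fin w) → Program w n c₁ c₂ → Program w n c₁ c₂
  | [], P => P
  | i :: L, P => .gate (.oneQubit hadamard i) (hadamardGatesRev L P)

theorem prepends_hadamardGates (u v : Fin n → FixedPoint c₁ c₂) (L : List (Fin w)) :
    Prepends u v (hadamardGates L) (hadamards L) 0 L.length := by
  induction L with
  | nil => exact fun _ _ _ _ _ => rfl
  | cons i L ih =>
    intro E P ψ q g
    rw [hadamardGates, ih]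
    simp only [Program.weightFrom, apply_oneQubit, Gate.cost, List.length_cons]
    rfl

theorem prepends_hadamardGatesRev (u v : Fin n → FixedPoint c₁ c₂) (L : List (Fin w)) :
    Prepends u v (hadamardGatesRev L) (hadamardsRev L) 0 L.length := by
  induction L with
  | nil => exact fun _ _ _ _ _ => rfl
  | cons i L ih =>
    intro E P ψ q g
    simp only [hadamardGatesRev, Program.weightFrom, apply_oneQubit, Gate.cost, List.length_cons]
    rw [ih, add_assoc, add_comm 1]
    rfl

theorem hadamards_hadamardsRev (L : List (Fin w)) (ψ : State w) :
    hadamards L (hadamardsRev L ψ) = ψ := by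
  induction L generalizing ψ with
  | nil => rfl
  | cons i L ih =>
    simp only [hadamards, hadamardsRev, LinearMap.comp_apply, ih]
    rw [qubitMap_comp i _ _ fun _ _ => rfl]
    exact qubitMap_one _ _ _ fun _ => hadamard_mul_self

theorem innerProd_hadamards (L : List (Fin w)) (φ ψ : State w) :
    innerProd (hadamards L φ) (hadamards L ψ) = innerProd φ ψ := by
  induction L with
  | nil => rfl
  | cons i L ih =>
    simp only [hadamards, LinearMap.comp_apply]
    rw [innerProd_qubitMap i _ (fun _ _ => rfl)
      (fun _ => Matrix.mem_unitaryGroup_iff'.1 hadamard.2), ih]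

theorem SupportedOn.hadamards {S : Set (Fin w)} {ψ : State w} (hψ : SupportedOn S ψ)
    {L : List (Fin w)} (hL : ∀ i ∈ L, i ∈ S) : SupportedOn S (hadamards L ψ) := by
  induction L with
  | nil => exact hψ
  | cons i L ih =>
    exact (ih fun j hj => hL j (List.mem_cons_of_mem _ hj)).qubitMap (hL i List.mem_cons_self) _

theorem SupportedOn.hadamardsRev {S : Set (Fin w)} {ψ : State w} (hψ : SupportedOn S ψ)
    {L : List (Fin w)} (hL : ∀ i ∈ L, i ∈ S) : SupportedOn S (hadamardsRev L ψ) := by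
  induction L generalizing ψ with
  | nil => exact hψ
  | cons i L ih =>
    exact ih (hψ.qubitMap (hL i List.mem_cons_self) _) fun j hj => hL j (List.mem_cons_of_mem _ hj)

-- Since the list has no duplicates, a qubit is still `0` just before its own Hadamard gate, so one
-- of the two terms vanishes.
open Classical in
theorem hadamards_zeroState (L : List (Fin w)) (hL : L.Nodup) (x : Fin w → Bool) :
    hadamards L (zeroState w) x =
      if ∀ q, q ∉ L → x q = false then ((Real.sqrt 2)⁻¹ : ℂ) ^ L.length else 0 := by
  induction L generalizing x with
  | nil =>
    simp only [hadamards, LinearMap.id_apply, zeroState, List.not_mem_nil, not_false_eq_true,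
      true_imp_iff, funext_iff, List.length_nil, pow_zero]
  | cons i L ih =>
    obtain ⟨hi, hL⟩ := List.nodup_cons.1 hL
    have h1 : ¬∀ q, q ∉ L → Function.update x i true q = false := fun h => by
      simpa using h i hi
    have h2 : (∀ q, q ∉ L → Function.update x i false q = false) ↔
        ∀ q, q ∉ i :: L → x q = false := by
      refine forall_congr' fun q => ?_
      by_cases hq : q = i
      · subst hq; simp
      · simp [hq]
    rw [hadamards, LinearMap.comp_apply, qubitMap_apply, ih hL, ih hL, if_neg h1]
    simp only [h2]
    split_ifs
    · simp [hadamard, pow_succ']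
    · simp

/-! ### Queries -/

section Query

variable (u : Fin n → FixedPoint c₁ c₂) (idx : Fin (Nat.clog 2 n) ↪ Fin w)
  (data : Fin c₁ ⊕ Fin c₂ ↪ Fin w)

theorem queryBasis_of_ne {q : Fin w} (hq : ∀ p, data p ≠ q) (x : Fin w → Bool) :
    queryBasis u idx data x q = x q := by
  unfold queryBasis
  split_ifs
  · simp [hq]
  · rfl

theorem queryBasis_data (p : Fin c₁ ⊕ Fin c₂) (x : Fin w → Bool) :
    queryBasis u idx data x (data p) = xor (x (data p)) (decide
      (∃ h : binaryValue (fun i => x (idx i)) < n, u ⟨_, h⟩ p = true)) := by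
  unfold queryBasis
  split_ifs with h
  · simp only [h, EmbeddingLike.apply_eq_iff_eq, exists_eq_left, exists_true_left]
  · simp [h]

theorem queryBasis_comp_idx (hd : ∀ i p, idx i ≠ data p) (x : Fin w → Bool) :
    (fun i => queryBasis u idx data x (idx i)) = fun i => x (idx i) :=
  funext fun i => queryBasis_of_ne u idx data (fun p => (hd i p).symm) x

theorem queryBasis_queryBasis (hd : ∀ i p, idx i ≠ data p) (x : Fin w → Bool) :
    queryBasis u idx data (queryBasis u idx data x) = x := by
  funext q
  by_cases hq : ∃ p, data p = q
  · obtain ⟨p, rfl⟩ := hq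
    simp only [queryBasis_data, queryBasis_comp_idx u idx data hd, Bool.xor_assoc, Bool.xor_self,
      Bool.xor_false]
  · push Not at hq
    rw [queryBasis_of_ne _ _ _ hq, queryBasis_of_ne _ _ _ hq]

theorem queryBasis_update {f : Fin w} (hf : ∀ i, idx i ≠ f) (hf' : ∀ p, data p ≠ f)
    (x : Fin w → Bool) (b : Bool) : queryBasis u idx data (Function.update x f b) =
      Function.update (queryBasis u idx data x) f b := by
  funext q
  by_cases hq : ∃ p, data p = q
  · obtain ⟨p, rfl⟩ := hq
    rw [Function.update_of_ne (hf' p), queryBasis_data, queryBasis_data,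
      Function.update_of_ne (hf' p)]
    simp only [Function.update_of_ne (hf _)]
  · push Not at hq
    rw [queryBasis_of_ne _ _ _ hq]
    by_cases hqf : q = f
    · subst hqf; simp
    · rw [Function.update_of_ne hqf, Function.update_of_ne hqf, queryBasis_of_ne _ _ _ hq]

end Query

/-- The number with index `r` in a list, or `0` if `r` is too large. -/
noncomputable def entryValue (u : Fin n → FixedPoint c₁ c₂) (r : Fin (Nat.clog 2 n) → Bool) : ℝ :=
  if h : binaryValue r < n then fixedPointValue (u ⟨binaryValue r, h⟩) else 0

theorem fixedPointValue_false : fixedPointValue (fun _ => false : FixedPoint c₁ c₂) = 0 := by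
  simp [fixedPointValue]

theorem fixedPointValue_nonneg (s : FixedPoint c₁ c₂) : 0 ≤ fixedPointValue s := by
  unfold fixedPointValue
  refine add_nonneg (Finset.sum_nonneg fun i _ => ?_) (Finset.sum_nonneg fun i _ => ?_) <;>
    split_ifs <;> positivity

theorem fixedPointValue_pos {s : FixedPoint c₁ c₂} {p : Fin c₁ ⊕ Fin c₂} (hp : s p = true) :
    0 < fixedPointValue s := by
  unfold fixedPointValue
  cases p with
  | inl i =>
    refine add_pos_of_pos_of_nonneg (Finset.sum_pos' (fun j _ => ?_) ⟨i, Finset.mem_univ _, ?_⟩)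
      (Finset.sum_nonneg fun j _ => ?_)
    · split_ifs <;> positivity
    · rw [if_pos hp]; positivity
    · split_ifs <;> positivity
  | inr i =>
    refine add_pos_of_nonneg_of_pos (Finset.sum_nonneg fun j _ => ?_)
      (Finset.sum_pos' (fun j _ => ?_) ⟨i, Finset.mem_univ _, ?_⟩)
    · split_ifs <;> positivity
    · split_ifs <;> positivity
    · rw [if_pos hp]; positivity

theorem fixedPointValue_queryBasis (u : Fin n → FixedPoint c₁ c₂)
    (idx : Fin (Nat.clog 2 n) ↪ Fin w) (data : Fin c₁ ⊕ Fin c₂ ↪ Fin w) (x : Fin w → Bool)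
    (hx : ∀ p, x (data p) = false) :
    fixedPointValue (fun p => queryBasis u idx data x (data p)) =
      entryValue u fun i => x (idx i) := by
  unfold entryValue
  split_ifs with h
  · congr 1
    funext p
    simp [queryBasis_data, hx, h]
  · rw [← fixedPointValue_false (c₁ := c₁) (c₂ := c₂)]
    congr 1
    funext p
    simp [queryBasis_data, hx, h]

end QuantumTrace

/-! ### The circuits for state preparation and reflection -/

namespace QuantumTrace

variable {w n c₁ c₂ : ℕ}

/-- The registers of the algorithm: an index register, two registers for the data, a flag that
marks the good states, and an ancilla. -/
structure Layout (w n c₁ c₂ : ℕ) where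
  idx : Fin (Nat.clog 2 n) ↪ Fin w
  data₁ : Fin c₁ ⊕ Fin c₂ ↪ Fin w
  data₂ : Fin c₁ ⊕ Fin c₂ ↪ Fin w
  flag : Fin w
  anc : Fin w
  idx_ne_data₁ : ∀ i p, idx i ≠ data₁ p
  idx_ne_data₂ : ∀ i p, idx i ≠ data₂ p
  data₁_ne_data₂ : ∀ p p', data₁ p ≠ data₂ p'
  idx_ne_flag : ∀ i, idx i ≠ flag
  data₁_ne_flag : ∀ p, data₁ p ≠ flag
  data₂_ne_flag : ∀ p, data₂ p ≠ flag
  idx_ne_anc : ∀ i, idx i ≠ anc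
  data₁_ne_anc : ∀ p, data₁ p ≠ anc
  flag_ne_anc : flag ≠ anc

theorem nonempty_layout (n c₁ c₂ : ℕ) : ∃ w, Nonempty (Layout w n c₁ c₂) := by
  let Q := Fin (Nat.clog 2 n) ⊕ ((Fin c₁ ⊕ Fin c₂) ⊕ ((Fin c₁ ⊕ Fin c₂) ⊕ Bool))
  let e : Q ≃ Fin (Fintype.card Q) := Fintype.equivFin Q
  refine ⟨Fintype.card Q, ⟨{
    idx := (Function.Embedding.inl).trans e.toEmbedding
    data₁ := (Function.Embedding.inl.trans Function.Embedding.inr).trans e.toEmbedding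
    data₂ := ((Function.Embedding.inl.trans Function.Embedding.inr).trans
      Function.Embedding.inr).trans e.toEmbedding
    flag := e (.inr (.inr (.inr true)))
    anc := e (.inr (.inr (.inr false)))
    idx_ne_data₁ := by intros; exact e.injective.ne nofun
    idx_ne_data₂ := by intros; exact e.injective.ne nofun
    data₁_ne_data₂ := by intros; exact e.injective.ne nofun
    idx_ne_flag := by intros; exact e.injective.ne nofun
    data₁_ne_flag := by intros; exact e.injective.ne nofun
    data₂_ne_flag := by intros; exact e.injective.ne nofun
    idx_ne_anc := by intros; exact e.injective.ne nofun
    data₁_ne_anc := by intros; exact e.injective.ne nofun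
    flag_ne_anc := e.injective.ne nofun }⟩⟩

namespace Layout

variable (ly : Layout w n c₁ c₂) (u v : Fin n → FixedPoint c₁ c₂) (s : ℝ)

/-- The index qubits and the flag. -/
def live : List (Fin w) := ly.flag :: List.ofFn ly.idx

theorem mem_live {q : Fin w} : q ∈ ly.live ↔ q = ly.flag ∨ ∃ i, ly.idx i = q := by
  simp [live, List.mem_ofFn]

theorem length_live : ly.live.length = Nat.clog 2 n + 1 := by simp [live]

theorem data₁_notMem_live (p : Fin c₁ ⊕ Fin c₂) : ly.data₁ p ∉ ly.live := fun h =>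
  (ly.mem_live.1 h).elim (ly.data₁_ne_flag p) fun ⟨i, hi⟩ => ly.idx_ne_data₁ i p hi

theorem data₂_notMem_live (p : Fin c₁ ⊕ Fin c₂) : ly.data₂ p ∉ ly.live := fun h =>
  (ly.mem_live.1 h).elim (ly.data₂_ne_flag p) fun ⟨i, hi⟩ => ly.idx_ne_data₂ i p hi

theorem anc_notMem_live : ly.anc ∉ ly.live := fun h =>
  (ly.mem_live.1 h).elim (Ne.symm ly.flag_ne_anc) fun ⟨i, hi⟩ => ly.idx_ne_anc i hi

/-! ### The controlled rotation by the products of the entries -/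

/-- The product of the numbers in the two data registers, scaled by `s`. -/
def productExpr : ArithExpr w c₁ c₂ := .mul (.const s) (.mul (.reg ly.data₁) (.reg ly.data₂))

theorem productExpr_avoids : (ly.productExpr s).Avoids ly.flag :=
  ⟨trivial, ly.data₁_ne_flag, ly.data₂_ne_flag⟩

/-- Query both inputs. -/
def load (x : Fin w → Bool) : Fin w → Bool :=
  queryBasis v ly.idx ly.data₂ (queryBasis u ly.idx ly.data₁ x)

/-- Undo the queries of `Layout.load`. -/
def unload (x : Fin w → Bool) : Fin w → Bool :=
  queryBasis u ly.idx ly.data₁ (queryBasis v ly.idx ly.data₂ x)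

theorem unload_load (x : Fin w → Bool) : ly.unload u v (ly.load u v x) = x := by
  rw [unload, load, queryBasis_queryBasis _ _ _ ly.idx_ne_data₂,
    queryBasis_queryBasis _ _ _ ly.idx_ne_data₁]

theorem load_flag (x : Fin w → Bool) : ly.load u v x ly.flag = x ly.flag := by
  rw [load, queryBasis_of_ne _ _ _ ly.data₂_ne_flag, queryBasis_of_ne _ _ _ ly.data₁_ne_flag]

theorem load_update (x : Fin w → Bool) (b : Bool) :
    ly.load u v (Function.update x ly.flag b) = Function.update (ly.load u v x) ly.flag b := by
  rw [load, queryBasis_update _ _ _ ly.idx_ne_flag ly.data₁_ne_flag,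
    queryBasis_update _ _ _ ly.idx_ne_flag ly.data₂_ne_flag, load]

theorem unload_update_load (x : Fin w → Bool) (b : Bool) :
    ly.unload u v (Function.update (ly.load u v x) ly.flag b) = Function.update x ly.flag b := by
  rw [← load_update, unload_load]

theorem productExpr_eval_update (x : Fin w → Bool) (b : Bool) :
    (ly.productExpr s).eval (Function.update x ly.flag b) = (ly.productExpr s).eval x := by
  simp only [productExpr, ArithExpr.eval, Function.update_of_ne (ly.data₁_ne_flag _),
    Function.update_of_ne (ly.data₂_ne_flag _)]

theorem productExpr_eval_load (x : Fin w → Bool) (h₁ : ∀ p, x (ly.data₁ p) = false)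
    (h₂ : ∀ p, x (ly.data₂ p) = false) : (ly.productExpr s).eval (ly.load u v x) =
      s * (entryValue u (fun i => x (ly.idx i)) * entryValue v fun i => x (ly.idx i)) := by
  have h3 : (fun p => ly.load u v x (ly.data₁ p)) =
      fun p => queryBasis u ly.idx ly.data₁ x (ly.data₁ p) := funext fun p =>
    queryBasis_of_ne _ _ _ (fun p' => (ly.data₁_ne_data₂ p p').symm) _
  simp only [productExpr, ArithExpr.eval]
  rw [h3, fixedPointValue_queryBasis _ _ _ _ h₁]
  unfold load
  rw [fixedPointValue_queryBasis, queryBasis_comp_idx _ _ _ ly.idx_ne_data₁]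
  intro p
  rw [queryBasis_of_ne _ _ _ (fun p' => ly.data₁_ne_data₂ p' p), h₂]

/-- The rotation of the flag that depends on the entries with the number in the index register. -/
noncomputable def entryRotation (x : Fin w → Bool) : Matrix Bool Bool ℂ :=
  rotationMatrix ((ly.productExpr s).eval (ly.load u v x))

theorem entryRotation_update (x : Fin w → Bool) (b : Bool) :
    ly.entryRotation u v s (Function.update x ly.flag b) = ly.entryRotation u v s x := by
  rw [entryRotation, load_update, productExpr_eval_update, entryRotation]

/-- Loading neither reads nor changes the flag. Conjugating a flag operation by it thus only
relabels the controls, and the data registers end up uncomputed. -/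
theorem qubitMap_conj_load (M : (Fin w → Bool) → Matrix Bool Bool ℂ) (ψ : State w) :
    (fun x => qubitMap ly.flag M (fun x => ψ (ly.unload u v x)) (ly.load u v x)) =
      qubitMap ly.flag (fun x => M (ly.load u v x)) ψ := by
  ext x
  simp only [qubitMap_apply, unload_update_load, load_flag]

/-- The gates and queries of the rotation of the flag. -/
noncomputable def rotateGates (P : Program w n c₁ c₂) : Program w n c₁ c₂ :=
  .query .first ly.idx ly.data₁ ly.idx_ne_data₁ <|
  .query .second ly.idx ly.data₂ ly.idx_ne_data₂ <|
  .gate (.rotation (ly.productExpr s) ly.flag (ly.productExpr_avoids s)) <|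
  .query .second ly.idx ly.data₂ ly.idx_ne_data₂ <|
  .query .first ly.idx ly.data₁ ly.idx_ne_data₁ P

theorem prepends_rotateGates : Prepends u v (ly.rotateGates s)
    (qubitMap ly.flag (ly.entryRotation u v s)) 4 3 := by
  intro E P ψ q g
  have h := ly.qubitMap_conj_load u v (fun x => rotationMatrix ((ly.productExpr s).eval x)) ψ
  simp only [rotateGates, Program.weightFrom, apply_rotation, Gate.cost]
  exact congrArg (fun φ => P.weightFrom u v E φ (q + 4) (g + 3)) h

/-- The gates and queries of the inverse rotation of the flag. -/
noncomputable def rotateGatesRev (P : Program w n c₁ c₂) : Program w n c₁ c₂ :=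
  .query .first ly.idx ly.data₁ ly.idx_ne_data₁ <|
  .query .second ly.idx ly.data₂ ly.idx_ne_data₂ <|
  .gate (.oneQubit phaseFlip ly.flag) <|
  .gate (.rotation (ly.productExpr s) ly.flag (ly.productExpr_avoids s)) <|
  .gate (.oneQubit phaseFlip ly.flag) <|
  .query .second ly.idx ly.data₂ ly.idx_ne_data₂ <|
  .query .first ly.idx ly.data₁ ly.idx_ne_data₁ P

theorem prepends_rotateGatesRev : Prepends u v (ly.rotateGatesRev s)
    (qubitMap ly.flag fun x => (ly.entryRotation u v s x)ᴴ) 4 5 := by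
  intro E P ψ q g
  have h := ly.qubitMap_conj_load u v (fun x => (rotationMatrix ((ly.productExpr s).eval x))ᴴ) ψ
  have h2 : ∀ φ : State w, qubitMap ly.flag (fun _ => phaseFlip.1)
      (qubitMap ly.flag (fun x => rotationMatrix ((ly.productExpr s).eval x))
        (qubitMap ly.flag (fun _ => phaseFlip.1) φ)) =
      qubitMap ly.flag (fun x => (rotationMatrix ((ly.productExpr s).eval x))ᴴ) φ := fun φ => by
    rw [qubitMap_comp ly.flag (fun x => rotationMatrix ((ly.productExpr s).eval x)) _ fun x b => by
        simp only [productExpr_eval_update], qubitMap_comp _ _ _ fun _ _ => rfl]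
    simp only [Matrix.mul_assoc, phaseFlip_mul_rotationMatrix_mul]
  simp only [rotateGatesRev, Program.weightFrom, apply_rotation, apply_oneQubit, Gate.cost]
  rw [h2]
  exact congrArg (fun φ => P.weightFrom u v E φ (q + 4) (g + 5)) h

/-! ### State preparation -/

/-- The state preparation. -/
noncomputable def prepare : State w →ₗ[ℂ] State w :=
  qubitMap ly.flag (ly.entryRotation u v s) ∘ₗ hadamards (List.ofFn ly.idx)

/-- The inverse of the state preparation. -/
noncomputable def prepareRev : State w →ₗ[ℂ] State w :=
  hadamardsRev (List.ofFn ly.idx) ∘ₗ qubitMap ly.flag fun x => (ly.entryRotation u v s x)ᴴ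

theorem prepare_prepareRev (ψ : State w) : ly.prepare u v s (ly.prepareRev u v s ψ) = ψ := by
  simp only [prepare, prepareRev, LinearMap.comp_apply, hadamards_hadamardsRev]
  rw [qubitMap_comp _ _ _ fun x b => by rw [entryRotation_update]]
  exact qubitMap_one _ _ _ fun x => rotationMatrix_mul_conjTranspose _

theorem innerProd_prepare (φ ψ : State w) :
    innerProd (ly.prepare u v s φ) (ly.prepare u v s ψ) = innerProd φ ψ := by
  simp only [prepare, LinearMap.comp_apply]
  rw [innerProd_qubitMap _ _ (ly.entryRotation_update u v s)
    fun x => conjTranspose_mul_rotationMatrix _, innerProd_hadamards]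

theorem mem_live_of_mem_idx : ∀ i ∈ List.ofFn ly.idx, i ∈ {q | q ∈ ly.live} := fun _ hi =>
  List.mem_cons_of_mem _ hi

theorem supportedOn_prepare {ψ : State w} (hψ : SupportedOn {q | q ∈ ly.live} ψ) :
    SupportedOn {q | q ∈ ly.live} (ly.prepare u v s ψ) :=
  (hψ.hadamards ly.mem_live_of_mem_idx).qubitMap List.mem_cons_self _

theorem supportedOn_prepareRev {ψ : State w} (hψ : SupportedOn {q | q ∈ ly.live} ψ) :
    SupportedOn {q | q ∈ ly.live} (ly.prepareRev u v s ψ) :=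
  (hψ.qubitMap List.mem_cons_self _).hadamardsRev ly.mem_live_of_mem_idx

/-- The gates and queries of the state preparation. -/
noncomputable def prepareGates (P : Program w n c₁ c₂) : Program w n c₁ c₂ :=
  hadamardGates (List.ofFn ly.idx) (ly.rotateGates s P)

theorem prepends_prepareGates :
    Prepends u v (ly.prepareGates s) (ly.prepare u v s) 4 (Nat.clog 2 n + 3) := by
  have h := (prepends_hadamardGates u v (List.ofFn ly.idx)).comp (ly.prepends_rotateGates u v s)
  rwa [List.length_ofFn, zero_add] at h

/-- The gates and queries of the inverse state preparation. -/
noncomputable def prepareGatesRev (P : Program w n c₁ c₂) : Program w n c₁ c₂ :=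
  ly.rotateGatesRev s (hadamardGatesRev (List.ofFn ly.idx) P)

theorem prepends_prepareGatesRev :
    Prepends u v (ly.prepareGatesRev s) (ly.prepareRev u v s) 4 (Nat.clog 2 n + 5) := by
  have h := (ly.prepends_rotateGatesRev u v s).comp
    (prepends_hadamardGatesRev u v (List.ofFn ly.idx))
  rwa [List.length_ofFn, add_zero, add_comm 5] at h

/-! ### The reflection at the zero state -/

/-- A register with the qubit `q` at position `p₀` and qubits of the first data register at all
other positions. -/
def probe (p₀ : Fin c₁ ⊕ Fin c₂) (q : Fin w) (hq : ∀ p, ly.data₁ p ≠ q) :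
    Fin c₁ ⊕ Fin c₂ ↪ Fin w where
  toFun p := if p = p₀ then q else ly.data₁ p
  inj' p p' h := by
    dsimp only at h
    split_ifs at h with h₁ h₂ h₂
    · rw [h₁, h₂]
    · exact absurd h.symm (hq _)
    · exact absurd h (hq _)
    · exact ly.data₁.injective h

theorem probe_apply (p₀ : Fin c₁ ⊕ Fin c₂) (q : Fin w) (hq : ∀ p, ly.data₁ p ≠ q)
    (p : Fin c₁ ⊕ Fin c₂) : ly.probe p₀ q hq p = if p = p₀ then q else ly.data₁ p := rfl

/-- One plus the sum of the registers that contain single qubits of a list. -/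
def zeroTest (p₀ : Fin c₁ ⊕ Fin c₂) : (L : List (Fin w)) → (∀ q ∈ L, q ∈ ly.live) →
    ArithExpr w c₁ c₂
  | [], _ => .const 1
  | q :: L, h => .add
      (.reg (ly.probe p₀ q fun p hp => ly.data₁_notMem_live p (hp ▸ h q List.mem_cons_self)))
      (zeroTest p₀ L fun q' hq' => h q' (List.mem_cons_of_mem _ hq'))

theorem zeroTest_avoids (p₀ : Fin c₁ ⊕ Fin c₂) (L : List (Fin w)) (h : ∀ q ∈ L, q ∈ ly.live) :
    (ly.zeroTest p₀ L h).Avoids ly.anc := by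
  induction L with
  | nil => trivial
  | cons q L ih =>
    refine ⟨fun p => ?_, ih _⟩
    rw [probe_apply]
    split_ifs
    · exact fun hq => ly.anc_notMem_live (hq ▸ h q List.mem_cons_self)
    · exact ly.data₁_ne_anc p

theorem zeroTest_numOps (p₀ : Fin c₁ ⊕ Fin c₂) (L : List (Fin w)) (h : ∀ q ∈ L, q ∈ ly.live) :
    (ly.zeroTest p₀ L h).numOps = L.length := by
  induction L with
  | nil => rfl
  | cons q L ih => simp [zeroTest, ArithExpr.numOps, ih]

theorem eval_update_of_avoids {i : Fin w} {e : ArithExpr w c₁ c₂} (he : e.Avoids i)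
    (x : Fin w → Bool) (b : Bool) : e.eval (Function.update x i b) = e.eval x := by
  induction e with
  | const r => rfl
  | reg R => simp only [ArithExpr.eval, Function.update_of_ne (he _)]
  | add e f ihe ihf => simp only [ArithExpr.eval, ihe he.1, ihf he.2]
  | sub e f ihe ihf => simp only [ArithExpr.eval, ihe he.1, ihf he.2]
  | mul e f ihe ihf => simp only [ArithExpr.eval, ihe he.1, ihf he.2]
  | div e f ihe ihf => simp only [ArithExpr.eval, ihe he.1, ihf he.2]

theorem zeroTest_eval_zero (p₀ : Fin c₁ ⊕ Fin c₂) (L : List (Fin w))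
    (h : ∀ q ∈ L, q ∈ ly.live) : (ly.zeroTest p₀ L h).eval (fun _ => false) = 1 := by
  induction L with
  | nil => rfl
  | cons q L ih => simp [zeroTest, ArithExpr.eval, ih, fixedPointValue_false]

theorem one_le_zeroTest_eval (p₀ : Fin c₁ ⊕ Fin c₂) (L : List (Fin w))
    (h : ∀ q ∈ L, q ∈ ly.live) (x : Fin w → Bool) : 1 ≤ (ly.zeroTest p₀ L h).eval x := by
  induction L with
  | nil => exact le_rfl
  | cons q L ih => exact le_add_of_nonneg_of_le (fixedPointValue_nonneg _) (ih _)

/-- A live qubit equal to `1` sits at position `p₀` of its own register and makes that value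
positive; the other registers contribute nonnegative amounts, whatever `data₁` contains. A value
above `1` switches the controlled rotation off. -/
theorem one_lt_zeroTest_eval (p₀ : Fin c₁ ⊕ Fin c₂) (L : List (Fin w))
    (h : ∀ q ∈ L, q ∈ ly.live) (x : Fin w → Bool) (hx : ∃ q ∈ L, x q = true) :
    1 < (ly.zeroTest p₀ L h).eval x := by
  induction L with
  | nil => simp at hx
  | cons q L ih =>
    by_cases hq : x q = true
    · refine lt_add_of_pos_of_le (fixedPointValue_pos (p := p₀) ?_) (one_le_zeroTest_eval _ _ _ _ _)
      rw [probe_apply, if_pos rfl, hq]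
    · refine lt_add_of_nonneg_of_lt (fixedPointValue_nonneg _) (ih _ ?_)
      simpa [hq] using hx

/-- The rotation of the ancilla by the angle `π / 2` if all live qubits are `0`. -/
noncomputable def zeroRotation (p₀ : Fin c₁ ⊕ Fin c₂) : Gate w c₁ c₂ :=
  .rotation (ly.zeroTest p₀ ly.live fun _ => id) ly.anc (ly.zeroTest_avoids _ _ _)

/-- The reflection at the zero state. -/
noncomputable def reflect (ψ : State w) : State w :=
  ψ + (-2 * ψ fun _ => false) • zeroState w

/-- The test value is `1` on the zero state, where two quarter turns give `-1`, and exceeds `1` if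
some live qubit is set, where the gate is trivial. On all other basis states `ψ` vanishes by its
support. -/
theorem zeroRotation_apply_apply (p₀ : Fin c₁ ⊕ Fin c₂) {ψ : State w}
    (hψ : SupportedOn {q | q ∈ ly.live} ψ) :
    (ly.zeroRotation p₀).apply ((ly.zeroRotation p₀).apply ψ) = reflect ψ := by
  have hd : ∀ x : Fin w → Bool,
      rotationMatrix ((ly.zeroTest p₀ ly.live fun _ => id).eval x) *
        rotationMatrix ((ly.zeroTest p₀ ly.live fun _ => id).eval x) =
      Matrix.diagonal fun _ => if (ly.zeroTest p₀ ly.live fun _ => id).eval x = 1 then -1 else 1 := by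
    intro x
    split_ifs with h
    · rw [h, rotationMatrix_one_mul_self]
    · rw [rotationMatrix_of_not_mem, one_mul, Matrix.diagonal_one]
      exact fun h' => h (le_antisymm h'.2 (ly.one_le_zeroTest_eval _ _ _ _))
  simp only [zeroRotation, apply_rotation]
  rw [qubitMap_comp _ _ _ fun x b => by rw [eval_update_of_avoids (ly.zeroTest_avoids _ _ _)]]
  ext x
  rw [qubitMap_diagonal _ _ _ _ hd]
  by_cases h0 : x = fun _ => false
  · subst h0
    simp only [zeroTest_eval_zero, if_true, reflect, Pi.add_apply, Pi.smul_apply, zeroState,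
      smul_eq_mul]
    ring
  · have h1 : reflect ψ x = ψ x := by simp [reflect, zeroState, h0]
    rw [h1]
    by_cases hx : ∃ q ∈ ly.live, x q = true
    · rw [if_neg (ly.one_lt_zeroTest_eval p₀ ly.live (fun _ => id) x hx).ne', one_mul]
    · push Not at hx
      obtain ⟨q, hq⟩ := Function.ne_iff.1 h0
      rw [hψ x q (fun hq' => hq (by simpa using hx q hq')) (by simpa using hq), mul_zero]

end Layout

end QuantumTrace

/-! ### Amplitude amplification as a source of coins -/

namespace QuantumTrace

variable {w n c₁ c₂ : ℕ}

theorem project_add_project (ψ : State w) (i : Fin w) :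
    ψ.project i false + ψ.project i true = ψ := by
  ext x
  cases h : x i <;> simp [State.project, h]

theorem project_project (ψ : State w) (i : Fin w) (b b' : Bool) :
    (ψ.project i b).project i b' = if b = b' then ψ.project i b else 0 := by
  ext x
  cases h : x i <;> cases b <;> cases b' <;> simp [State.project, h]

theorem innerProd_project (ψ : State w) (i : Fin w) (b : Bool) :
    innerProd ψ (ψ.project i b) = ((ψ.project i b).weight : ℂ) := by
  rw [← innerProd_self]
  refine Finset.sum_congr rfl fun x _ => ?_
  by_cases h : x i = b <;> simp [State.project, h]

theorem project_lincomb (φ ψ : State w) (i : Fin w) (b : Bool) (c d : ℂ) :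
    State.project (c • φ + d • ψ) i b = c • φ.project i b + d • ψ.project i b := by
  ext x
  by_cases h : x i = b <;> simp [State.project, h]

theorem qubitMap_phaseFlip (i : Fin w) (ψ : State w) (x : Fin w → Bool) :
    qubitMap i (fun _ => phaseFlip.1) ψ x = (if x i then -1 else 1) * ψ x :=
  qubitMap_diagonal i _ ψ (fun _ r => if r then -1 else 1) (fun _ => rfl) x

namespace Layout

variable (ly : Layout w n c₁ c₂) (u v : Fin n → FixedPoint c₁ c₂) (s : ℝ) (p₀ : Fin c₁ ⊕ Fin c₂)

/-! ### Amplitude amplification -/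

/-- The state that is prepared from the zero state. -/
noncomputable def start : State w := ly.prepare u v s (zeroState w)

theorem supportedOn_start : SupportedOn {q | q ∈ ly.live} (ly.start u v s) :=
  ly.supportedOn_prepare u v s (supportedOn_zeroState _)

/-- The amplitude amplification step. -/
noncomputable def grover (ψ : State w) : State w :=
  ly.prepare u v s ((ly.zeroRotation p₀).apply ((ly.zeroRotation p₀).apply
    (ly.prepareRev u v s (qubitMap ly.flag (fun _ => phaseFlip.1) ψ))))

/-- The gates and queries of the amplitude amplification step. -/
noncomputable def groverGates (P : Program w n c₁ c₂) : Program w n c₁ c₂ :=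
  .gate (.oneQubit phaseFlip ly.flag) <| ly.prepareGatesRev s <|
  .gate (ly.zeroRotation p₀) <| .gate (ly.zeroRotation p₀) <| ly.prepareGates s P

theorem cost_zeroRotation : (ly.zeroRotation p₀).cost = Nat.clog 2 n + 2 := by
  rw [zeroRotation, Gate.cost, zeroTest_numOps, length_live]

theorem prepends_groverGates : Prepends u v (ly.groverGates s p₀) (ly.grover u v s p₀) 8
    (4 * Nat.clog 2 n + 13) := by
  intro E P ψ q g
  simp only [groverGates, Program.weightFrom, ly.prepends_prepareGatesRev u v s _ _ _ _ _,
    ly.prepends_prepareGates u v s _ _ _ _ _, cost_zeroRotation, apply_oneQubit]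
  rw [grover]
  congr 1
  simp only [Gate.cost]
  ring

/-- Preparation is an isometry with right inverse `prepareRev`, so it carries the reflection at the
zero state to the reflection at `start`; the amplitude at zero becomes an inner product with
`start`. -/
theorem grover_eq {ψ : State w} (hψ : SupportedOn {q | q ∈ ly.live} ψ) :
    ly.grover u v s p₀ ψ = qubitMap ly.flag (fun _ => phaseFlip.1) ψ +
      (-2 * innerProd (ly.start u v s) (qubitMap ly.flag (fun _ => phaseFlip.1) ψ)) •
        ly.start u v s := by
  have h1 := hψ.qubitMap (i := ly.flag) List.mem_cons_self (fun _ => phaseFlip.1)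
  have h2 := ly.supportedOn_prepareRev u v s h1
  rw [grover, ly.zeroRotation_apply_apply p₀ h2, reflect, map_add, map_smul, prepare_prepareRev]
  have h3 := ly.innerProd_prepare u v s (zeroState w)
    (ly.prepareRev u v s (qubitMap ly.flag (fun _ => phaseFlip.1) ψ))
  rw [prepare_prepareRev, innerProd_zeroState] at h3
  rw [← h3]
  rfl

theorem weight_start : (ly.start u v s).weight = 1 := by
  have h := ly.innerProd_prepare u v s (zeroState w) (zeroState w)
  rw [innerProd_self, innerProd_self, weight_zeroState] at h
  exact_mod_cast h

theorem grover_lincomb (c d : ℂ) :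
    ly.grover u v s p₀ (c • (ly.start u v s).project ly.flag false +
        d • (ly.start u v s).project ly.flag true) =
      (c - 2 * (c * ((ly.start u v s).project ly.flag false).weight -
        d * ((ly.start u v s).project ly.flag true).weight)) •
        (ly.start u v s).project ly.flag false +
      (-d - 2 * (c * ((ly.start u v s).project ly.flag false).weight -
        d * ((ly.start u v s).project ly.flag true).weight)) •
        (ly.start u v s).project ly.flag true := by
  have hs := ly.supportedOn_start u v s
  rw [grover_eq _ _ _ _ _ (((hs.project _ _).smul _).add ((hs.project _ _).smul _))]
  have hz : qubitMap ly.flag (fun _ => phaseFlip.1)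
      (c • (ly.start u v s).project ly.flag false + d • (ly.start u v s).project ly.flag true) =
      c • (ly.start u v s).project ly.flag false +
        (-d) • (ly.start u v s).project ly.flag true := by
    ext x
    rw [qubitMap_phaseFlip]
    cases h : x ly.flag <;> simp [State.project, h]
  rw [hz, innerProd_add_right, innerProd_smul_right, innerProd_smul_right, innerProd_project,
    innerProd_project]
  have hsplit : ∀ a : ℂ, a • ly.start u v s = a • (ly.start u v s).project ly.flag false +
      a • (ly.start u v s).project ly.flag true := fun a => by
    rw [← smul_add, project_add_project]
  rw [hsplit]
  module

/-- The two projections of `start` span an invariant plane. Divided by their norms `cos θ` and `sin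
θ`, they are an orthonormal basis in which `start` has angle `θ` and each step is minus the rotation
by `2 * θ`; hence the sign `(-1) ^ k`. -/
theorem grover_iterate {θ : ℝ} (hs : Real.sin θ ≠ 0) (hc : Real.cos θ ≠ 0)
    (hw : ((ly.start u v s).project ly.flag true).weight = Real.sin θ ^ 2) (k : ℕ) :
    (ly.grover u v s p₀)^[k] (ly.start u v s) =
      (((-1) ^ k * (Real.cos ((2 * k + 1) * θ) / Real.cos θ) : ℝ) : ℂ) •
        (ly.start u v s).project ly.flag false +
      (((-1) ^ k * (Real.sin ((2 * k + 1) * θ) / Real.sin θ) : ℝ) : ℂ) •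
        (ly.start u v s).project ly.flag true := by
  have hw' : ((ly.start u v s).project ly.flag false).weight = Real.cos θ ^ 2 := by
    have h := sum_weight_project (ly.start u v s) ly.flag
    rw [Fintype.sum_bool, hw, weight_start] at h
    linarith [Real.sin_sq_add_cos_sq θ]
  induction k with
  | zero => simp [hs, hc, project_add_project]
  | succ k ih =>
    rw [Function.iterate_succ_apply', ih, grover_lincomb, hw, hw']
    have e1 : (2 * ((k + 1 : ℕ) : ℝ) + 1) * θ = (2 * k + 1) * θ + 2 * θ := by push_cast; ring
    have hc2 : Real.cos θ ^ 2 = 1 - Real.sin θ ^ 2 := by linarith [Real.sin_sq_add_cos_sq θ]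
    congr 2
    · have h : (-1) ^ k * (Real.cos ((2 * k + 1) * θ) / Real.cos θ) -
          2 * ((-1) ^ k * (Real.cos ((2 * k + 1) * θ) / Real.cos θ) * Real.cos θ ^ 2 -
            (-1) ^ k * (Real.sin ((2 * k + 1) * θ) / Real.sin θ) * Real.sin θ ^ 2) =
          (-1) ^ (k + 1) * (Real.cos ((2 * (k + 1 : ℕ) + 1) * θ) / Real.cos θ) := by
        rw [e1, Real.cos_add, Real.cos_two_mul, Real.sin_two_mul, pow_succ]
        field_simp
        ring
      exact_mod_cast congrArg Complex.ofReal h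
    · have h : -((-1) ^ k * (Real.sin ((2 * k + 1) * θ) / Real.sin θ)) -
          2 * ((-1) ^ k * (Real.cos ((2 * k + 1) * θ) / Real.cos θ) * Real.cos θ ^ 2 -
            (-1) ^ k * (Real.sin ((2 * k + 1) * θ) / Real.sin θ) * Real.sin θ ^ 2) =
          (-1) ^ (k + 1) * (Real.sin ((2 * (k + 1 : ℕ) + 1) * θ) / Real.sin θ) := by
        rw [e1, Real.sin_add, Real.cos_two_mul, Real.sin_two_mul, pow_succ]
        field_simp
        rw [hc2]
        ring
      exact_mod_cast congrArg Complex.ofReal h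

/-! ### Measurement of the flag -/

/-- Prepare the state, apply `k` steps of amplitude amplification, measure the flag, and reset all
qubits. -/
noncomputable def sample (k : ℕ) (next : Bool → Program w n c₁ c₂) : Program w n c₁ c₂ :=
  ly.prepareGates s ((ly.groverGates s p₀)^[k]
    (.measure ly.flag fun b => resetQubits ly.live (next b)))

/-- The preparation uses `4` queries and each step `8`. The gates are those of the preparation and
of `k` steps, one measurement, and two per live qubit for the reset. -/
theorem weightFrom_sample {θ : ℝ} (hs : Real.sin θ ≠ 0) (hc : Real.cos θ ≠ 0)
    (hw : ((ly.start u v s).project ly.flag true).weight = Real.sin θ ^ 2) (k : ℕ)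
    (next : Bool → Program w n c₁ c₂) (E : ℝ → ℕ → ℕ → Prop) (q g : ℕ) :
    (ly.sample s p₀ k next).weightFrom u v E (zeroState w) q g =
      Real.sin ((2 * k + 1) * θ) ^ 2 * (next true).weightFrom u v E (zeroState w)
        (q + 4 * (2 * k + 1)) (g + (k * (4 * Nat.clog 2 n + 13) + 3 * Nat.clog 2 n + 6)) +
      (1 - Real.sin ((2 * k + 1) * θ) ^ 2) * (next false).weightFrom u v E (zeroState w)
        (q + 4 * (2 * k + 1)) (g + (k * (4 * Nat.clog 2 n + 13) + 3 * Nat.clog 2 n + 6)) := by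
  have hw' : ((ly.start u v s).project ly.flag false).weight = Real.cos θ ^ 2 := by
    have h := sum_weight_project (ly.start u v s) ly.flag
    rw [Fintype.sum_bool, hw, weight_start] at h
    linarith [Real.sin_sq_add_cos_sq θ]
  have hsup : ∀ b : Bool, SupportedOn {q | q ∈ ly.live}
      (State.project ((ly.grover u v s p₀)^[k] (ly.start u v s)) ly.flag b) := by
    intro b
    rw [grover_iterate ly u v s p₀ hs hc hw]
    have h0 := ly.supportedOn_start u v s
    exact (((h0.project _ _).smul _).add ((h0.project _ _).smul _)).project _ _
  have hpow : ((-1 : ℝ) ^ k) ^ 2 = 1 := by rw [← pow_mul, mul_comm, pow_mul]; norm_num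
  have ht : State.weight (State.project ((ly.grover u v s p₀)^[k] (ly.start u v s)) ly.flag true) =
      Real.sin ((2 * k + 1) * θ) ^ 2 := by
    rw [grover_iterate ly u v s p₀ hs hc hw, project_lincomb, project_project, project_project]
    simp only [Bool.false_eq_true, if_false, smul_zero, zero_add, if_true, weight_smul, hw,
      Complex.norm_real, Real.norm_eq_abs, sq_abs]
    rw [mul_pow, hpow]
    field_simp
  have hf : State.weight (State.project ((ly.grover u v s p₀)^[k] (ly.start u v s)) ly.flag false) =
      1 - Real.sin ((2 * k + 1) * θ) ^ 2 := by
    rw [grover_iterate ly u v s p₀ hs hc hw, project_lincomb, project_project, project_project]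
    simp only [Bool.true_eq_false, if_false, smul_zero, add_zero, if_true, weight_smul, hw',
      Complex.norm_real, Real.norm_eq_abs, sq_abs]
    rw [mul_pow, hpow, ← Real.cos_sq']
    field_simp
  rw [sample, ly.prepends_prepareGates u v s, (ly.prepends_groverGates u v s p₀).iterate k]
  change (Program.measure _ _).weightFrom u v E ((ly.grover u v s p₀)^[k] (ly.start u v s)) _ _ = _
  simp only [Program.weightFrom, weightFrom_resetQubits _ _ _ _ _ _ (hsup _), Fintype.sum_bool,
    ht, hf, length_live]
  congr 3 <;> ring

/-! ### The probability of the flag -/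

/-- The basis state with index `r` and flag `1`. -/
noncomputable def flagged (r : Fin (Nat.clog 2 n) → Bool) : Fin w → Bool :=
  Function.update (Function.extend ly.idx r fun _ => false) ly.flag true

theorem flagged_idx (r : Fin (Nat.clog 2 n) → Bool) :
    (fun i => ly.flagged r (ly.idx i)) = r := by
  funext i
  rw [flagged, Function.update_of_ne (ly.idx_ne_flag i), ly.idx.injective.extend_apply]

theorem flagged_of_notMem_live (r : Fin (Nat.clog 2 n) → Bool) {q : Fin w} (hq : q ∉ ly.live) :
    ly.flagged r q = false := by
  rw [mem_live] at hq
  push Not at hq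
  rw [flagged, Function.update_of_ne hq.1, Function.extend_apply']
  exact fun ⟨i, hi⟩ => hq.2 i hi

/-- The flagged part of `start` lives on the states `flagged r`, because all qubits outside `live`
are `0`. There the amplitude is the square root of the scaled product times `(√2)⁻¹` for each index
qubit. -/
theorem weight_project_start
    (h01 : ∀ r, 0 ≤ s * (entryValue u r * entryValue v r) ∧
      s * (entryValue u r * entryValue v r) ≤ 1) :
    ((ly.start u v s).project ly.flag true).weight =
      ∑ r, s * (entryValue u r * entryValue v r) / 2 ^ Nat.clog 2 n := by
  classical
  have hinj : Function.Injective ly.flagged := fun r r' h => by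
    rw [← ly.flagged_idx r, h, ly.flagged_idx r']
  have hnd : (List.ofFn ly.idx).Nodup := List.nodup_ofFn.2 ly.idx.injective
  unfold State.weight
  symm
  refine Fintype.sum_of_injective ly.flagged hinj _ _ (fun x hx => ?_) fun r => ?_
  · by_cases hf : x ly.flag = true
    · have hex : ∃ q, q ∉ ly.live ∧ x q = true := by
        by_contra! hcon
        refine hx ⟨fun i => x (ly.idx i), funext fun q => ?_⟩
        by_cases hq : q ∈ ly.live
        · rcases ly.mem_live.1 hq with rfl | ⟨i, rfl⟩
          · rw [hf]; simp [flagged]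
          · exact congrFun (ly.flagged_idx fun i => x (ly.idx i)) i
        · rw [ly.flagged_of_notMem_live _ hq]
          simpa using (hcon q hq)
      obtain ⟨q, hq, hxq⟩ := hex
      simp [((ly.supportedOn_start u v s).project ly.flag true) x q hq hxq]
    · simp [State.project, hf]
  · have hflag : ly.flagged r ly.flag = true := by simp [flagged]
    have hrot : ly.entryRotation u v s (ly.flagged r) =
        rotationMatrix (s * (entryValue u r * entryValue v r)) := by
      rw [entryRotation, productExpr_eval_load, flagged_idx]
      · exact fun p => ly.flagged_of_notMem_live r (ly.data₁_notMem_live p)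
      · exact fun p => ly.flagged_of_notMem_live r (ly.data₂_notMem_live p)
    have ht : ¬∀ q, q ∉ List.ofFn ly.idx → Function.update (ly.flagged r) ly.flag true q = false :=
      fun h => by
        have h2 := h ly.flag fun h3 => by
          obtain ⟨i, hi⟩ := (List.mem_ofFn).1 h3
          exact ly.idx_ne_flag i hi
        simp at h2
    have hf : ∀ q, q ∉ List.ofFn ly.idx → Function.update (ly.flagged r) ly.flag false q = false :=
      fun q hq => by
        by_cases hqf : q = ly.flag
        · subst hqf; simp
        · rw [Function.update_of_ne hqf]
          refine ly.flagged_of_notMem_live r fun hm => ?_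
          exact (List.mem_cons.1 hm).elim hqf hq
    have hst : ly.start u v s (ly.flagged r) =
        (Real.sqrt (s * (entryValue u r * entryValue v r)) : ℂ) *
          ((Real.sqrt 2)⁻¹ : ℂ) ^ Nat.clog 2 n := by
      rw [start, prepare, LinearMap.comp_apply, qubitMap_apply, hrot,
        hadamards_zeroState _ hnd, hadamards_zeroState _ hnd, if_neg ht, if_pos hf, hflag,
        rotationMatrix_of_mem (h01 r) true false, List.length_ofFn, mul_zero, zero_add]
    simp only [State.project, hflag, if_true, hst, norm_mul, norm_pow, norm_inv, Complex.norm_real,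
      Real.norm_eq_abs, mul_pow, sq_abs]
    rw [Real.sq_sqrt (h01 r).1, abs_of_nonneg (Real.sqrt_nonneg 2), ← pow_mul, mul_comm _ 2,
      pow_mul, inv_pow, Real.sq_sqrt (by norm_num), inv_pow, div_eq_mul_inv]

end Layout

end QuantumTrace

/-! ### Majority votes and the choice of the coin -/

namespace QuantumTrace

/-! ### Adaptive experiments with coins -/

/-- An adaptive experiment that flips coins from a sequence of coins and outputs a real number. -/
inductive CoinTree : Type
  | out (I : ℝ)
  | flip (k : ℕ) (next : Bool → CoinTree)

namespace CoinTree

/-- The probability that the output `I` and the total cost `c` satisfy `F`, where coin `k` shows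
heads with probability `p k` and costs `2 * k + 1`. -/
noncomputable def success (p : ℕ → ℝ) (F : ℝ → ℕ → Prop) : CoinTree → ℕ → ℝ
  | out I, c => open Classical in if F I c then 1 else 0
  | flip k next, c => p k * success p F (next true) (c + (2 * k + 1)) +
      (1 - p k) * success p F (next false) (c + (2 * k + 1))

/-- Flip coin `k` another `r` times and continue with the number of heads, where `j` heads have
been seen before. -/
def vote (k : ℕ) (next : ℕ → CoinTree) : ℕ → ℕ → CoinTree
  | 0, j => next j
  | r + 1, j => flip k fun b => vote k next r (if b then j + 1 else j)

variable {p : ℕ → ℝ} {F : ℝ → ℕ → Prop}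

theorem success_nonneg (hp : ∀ k, 0 ≤ p k ∧ p k ≤ 1) (t : CoinTree) (c : ℕ) :
    0 ≤ t.success p F c := by
  induction t generalizing c with
  | out I => simp only [success]; split_ifs <;> norm_num
  | flip k next ih =>
    have h0 := mul_nonneg (hp k).1 (ih true (c + (2 * k + 1)))
    have h1 := mul_nonneg (sub_nonneg.2 (hp k).2) (ih false (c + (2 * k + 1)))
    exact add_nonneg h0 h1

/-- The subtracted term is the expectation of `y ^ j / Y` for the final number `j` of heads, so a
bound at the leaves propagates to the root without loss. -/
theorem le_success_vote_of_exp (hp : ∀ k, 0 ≤ p k ∧ p k ≤ 1) (k : ℕ) (next : ℕ → CoinTree)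
    (r j c : ℕ) (V y Y : ℝ)
    (h : ∀ j, V - y ^ j / Y ≤ (next j).success p F (c + r * (2 * k + 1))) :
    V - (1 - p k + p k * y) ^ r * y ^ j / Y ≤ (vote k next r j).success p F c := by
  induction r generalizing c j with
  | zero => simpa [vote] using h j
  | succ r ih =>
    have hc : c + (2 * k + 1) + r * (2 * k + 1) = c + (r + 1) * (2 * k + 1) := by ring
    have h1 := mul_le_mul_of_nonneg_left
      (ih (j + 1) (c + (2 * k + 1)) (by rw [hc]; exact h)) (hp k).1
    have h0 := mul_le_mul_of_nonneg_left
      (ih j (c + (2 * k + 1)) (by rw [hc]; exact h)) (sub_nonneg.2 (hp k).2)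
    simp only [vote, success, if_true, Bool.false_eq_true, if_false]
    refine le_trans (le_of_eq ?_) (add_le_add h1 h0)
    ring

theorem le_success_vote_of_forall (hp : ∀ k, 0 ≤ p k ∧ p k ≤ 1) (k : ℕ) (next : ℕ → CoinTree)
    (r j c : ℕ) {V : ℝ} (h : ∀ j, V ≤ (next j).success p F (c + r * (2 * k + 1))) :
    V ≤ (vote k next r j).success p F c := by
  induction r generalizing c j with
  | zero => simpa [vote] using h j
  | succ r ih =>
    have hc : c + (2 * k + 1) + r * (2 * k + 1) = c + (r + 1) * (2 * k + 1) := by ring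
    have h1 := mul_le_mul_of_nonneg_left
      (ih (j + 1) (c + (2 * k + 1)) (by rw [hc]; exact h)) (hp k).1
    have h0 := mul_le_mul_of_nonneg_left
      (ih j (c + (2 * k + 1)) (by rw [hc]; exact h)) (sub_nonneg.2 (hp k).2)
    simp only [vote, success, if_true, Bool.false_eq_true, if_false]
    linarith

/-- Chernoff bound with the tilt `y = (1 - p₀) / p₀`, which is optimal for bias `p₀` and threshold
`R` out of `2 * R`. The sign condition `hpp` covers both tails: `p k ≤ p₀ ≤ 1 / 2` with `y ≥ 1`, and
`p k ≥ p₀ ≥ 1 / 2` with `y ≤ 1`. -/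
theorem le_success_vote (hp : ∀ k, 0 ≤ p k ∧ p k ≤ 1) (k : ℕ) (next : ℕ → CoinTree) (R c : ℕ)
    {V p₀ : ℝ} (hV : V ≤ 1) (h0 : 0 < p₀) (h1 : p₀ < 1) (hpp : (p k - p₀) * (1 - 2 * p₀) ≤ 0)
    (h : ∀ j, ((1 - p₀) / p₀) ^ R ≤ ((1 - p₀) / p₀) ^ j ∨
      V ≤ (next j).success p F (c + 2 * R * (2 * k + 1))) :
    V - (4 * p₀ * (1 - p₀)) ^ R ≤ (vote k next (2 * R) 0).success p F c := by
  have hy : 0 < (1 - p₀) / p₀ := div_pos (by linarith) h0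
  refine le_trans ?_ (le_success_vote_of_exp hp k next (2 * R) 0 c V ((1 - p₀) / p₀)
    (((1 - p₀) / p₀) ^ R) fun j => ?_)
  · have hb : 1 - p k + p k * ((1 - p₀) / p₀) ≤ 2 * (1 - p₀) := by
      have : 1 - p k + p k * ((1 - p₀) / p₀) = 2 * (1 - p₀) + (p k - p₀) * (1 - 2 * p₀) / p₀ := by
        field_simp; ring
      rw [this]
      have := div_nonpos_of_nonpos_of_nonneg hpp h0.le
      linarith
    have hb0 : 0 ≤ 1 - p k + p k * ((1 - p₀) / p₀) :=
      add_nonneg (sub_nonneg.2 (hp k).2) (mul_nonneg (hp k).1 hy.le)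
    have hb2 : (1 - p k + p k * ((1 - p₀) / p₀)) ^ (2 * R) ≤ (2 * (1 - p₀)) ^ (2 * R) :=
      pow_le_pow_left₀ hb0 hb _
    have he : (4 * p₀ * (1 - p₀)) ^ R = (2 * (1 - p₀)) ^ (2 * R) / ((1 - p₀) / p₀) ^ R := by
      rw [pow_mul, ← div_pow]
      congr 1
      have : 1 - p₀ ≠ 0 := by linarith
      field_simp
      ring
    rw [he, pow_zero, mul_one]
    gcongr
  · rcases h j with h | h
    -- For a misleading count `j` the penalty is at least `1 ≥ V`, so nothing is required of the
    -- continuation.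
    · have : 1 ≤ ((1 - p₀) / p₀) ^ j / ((1 - p₀) / p₀) ^ R := by
        rw [le_div_iff₀ (pow_pos hy R), one_mul]; exact h
      exact le_trans (by linarith) (success_nonneg hp _ _)
    · have : 0 ≤ ((1 - p₀) / p₀) ^ j / ((1 - p₀) / p₀) ^ R := by positivity
      linarith

theorem le_success_vote_of_le (hp : ∀ k, 0 ≤ p k ∧ p k ≤ 1) (k : ℕ) (next : ℕ → CoinTree)
    (R c : ℕ) {V p₀ : ℝ} (hV : V ≤ 1) (h0 : 0 < p₀) (h1 : p₀ ≤ 1 / 2) (hpp : p k ≤ p₀)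
    (h : ∀ j, j < R → V ≤ (next j).success p F (c + 2 * R * (2 * k + 1))) :
    V - (4 * p₀ * (1 - p₀)) ^ R ≤ (vote k next (2 * R) 0).success p F c := by
  refine le_success_vote hp k next R c hV h0 (by linarith)
    (mul_nonpos_of_nonpos_of_nonneg (by linarith) (by linarith)) fun j => ?_
  rcases lt_or_ge j R with hj | hj
  · exact Or.inr (h j hj)
  · exact Or.inl (pow_le_pow_right₀ (by rw [le_div_iff₀ h0]; linarith) hj)

theorem le_success_vote_of_ge (hp : ∀ k, 0 ≤ p k ∧ p k ≤ 1) (k : ℕ) (next : ℕ → CoinTree)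
    (R c : ℕ) {V p₀ : ℝ} (hV : V ≤ 1) (h0 : 1 / 2 ≤ p₀) (h1 : p₀ < 1) (hpp : p₀ ≤ p k)
    (h : ∀ j, R ≤ j → V ≤ (next j).success p F (c + 2 * R * (2 * k + 1))) :
    V - (4 * p₀ * (1 - p₀)) ^ R ≤ (vote k next (2 * R) 0).success p F c := by
  have h0' : 0 < p₀ := by linarith
  refine le_success_vote hp k next R c hV h0' h1
    (mul_nonpos_of_nonneg_of_nonpos (by linarith) (by linarith)) fun j => ?_
  rcases le_or_gt R j with hj | hj
  · exact Or.inr (h j hj)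
  · exact Or.inl (pow_le_pow_of_le_one (div_nonneg (by linarith) h0'.le)
      (by rw [div_le_one h0']; linarith) hj.le)

/-! ### One step of the search -/

/-- The number of half turns that an angle in the middle of `[l, h]` is brought to. -/
noncomputable def turns (l h : ℝ) : ℕ := ⌊((l + h) / (h - l) - 1) / 2⌋₊

/-- The coin that separates the lower third of `[l, h]` from the upper third. -/
noncomputable def coin (l h : ℝ) : ℕ := ⌊(2 * turns l h + 1) * Real.pi / (4 * (l + h))⌋₊

/-- Decide by a majority of `2 * R` coins whether to continue with the upper part or with the
lower part of `[l, h]`. -/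
noncomputable def bisect (l h : ℝ) (R : ℕ) (next : Bool → CoinTree) : CoinTree :=
  vote (coin l h) (fun j => next (decide (R ≤ j) == decide (Even (turns l h)))) (2 * R) 0

section Angles

variable {l h : ℝ}

/-- `2 * turns l h + 1` is the largest odd number below or equal to `(l + h) / (h - l) ≥ 1`. It
therefore loses at most a factor `3`, which is `lt_turns`. -/
theorem turns_le (hl : 0 ≤ l) (hlh : l < h) : (2 * turns l h + 1) * (h - l) ≤ l + h := by
  have hd : 0 < h - l := by linarith
  have h1 : 1 ≤ (l + h) / (h - l) := by rw [le_div_iff₀ hd]; linarith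
  have h2 : (turns l h : ℝ) ≤ ((l + h) / (h - l) - 1) / 2 := Nat.floor_le (by linarith)
  rw [← le_div_iff₀ hd]
  linarith

theorem lt_turns (hlh : l < h) : l + h ≤ 3 * ((2 * turns l h + 1) * (h - l)) := by
  have hd : 0 < h - l := by linarith
  have h2 : ((l + h) / (h - l) - 1) / 2 < (turns l h : ℝ) + 1 := Nat.lt_floor_add_one _
  have h3 : (l + h) / (h - l) ≤ 3 * (2 * turns l h + 1) := by
    have : (0 : ℝ) ≤ turns l h := Nat.cast_nonneg _
    linarith
  rw [div_le_iff₀ hd] at h3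
  linarith

/-- `2 * coin l h + 1` differs by at most `1` from the real factor that takes the midpoint exactly
to an odd multiple of `π / 4`, where `sin ^ 2` equals `1 / 2` and is steepest. -/
theorem abs_coin_sub_le (hl : 0 ≤ l) (hlh : l < h) :
    |(2 * coin l h + 1) * ((l + h) / 2) - (2 * turns l h + 1) * Real.pi / 4| ≤ (l + h) / 2 := by
  have hs : 0 < l + h := by linarith
  set y := (2 * turns l h + 1) * Real.pi / (4 * (l + h)) with hy
  have h0 : 0 ≤ y := by positivity
  have h1 : (coin l h : ℝ) ≤ y := Nat.floor_le h0
  have h2 : y < (coin l h : ℝ) + 1 := Nat.lt_floor_add_one _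
  have h3 : (2 * turns l h + 1) * Real.pi / 4 = 2 * y * ((l + h) / 2) := by
    rw [hy]; field_simp
  rw [h3, ← sub_mul, abs_mul, abs_of_pos (half_pos hs)]
  refine mul_le_of_le_one_left (half_pos hs).le (abs_le.2 ⟨?_, ?_⟩) <;> linarith

/-- Measured from that odd multiple of `π / 4`, the coin is a sine with sign `(-1) ^ turns l h`.
This is why `bisect` compares the majority with the parity of `turns l h`. -/
theorem sin_sq_coin (θ : ℝ) : Real.sin ((2 * coin l h + 1) * θ) ^ 2 =
    1 / 2 + (-1) ^ turns l h *
      Real.sin (2 * ((2 * coin l h + 1) * θ - (2 * turns l h + 1) * Real.pi / 4)) / 2 := by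
  set ψ := (2 * coin l h + 1) * θ - (2 * turns l h + 1) * Real.pi / 4 with hψ
  have h1 : 2 * ((2 * coin l h + 1) * θ) = (2 * ψ + Real.pi / 2) + turns l h * Real.pi := by
    rw [hψ]; ring
  rw [Real.sin_sq_eq_half_sub, h1, Real.cos_add_nat_mul_pi, Real.cos_add_pi_div_two]
  ring

theorem le_sin_of_mem {y : ℝ} (h1 : 1 / 10 ≤ y) (h2 : y ≤ 2) : 3 / 50 ≤ Real.sin y := by
  have hpi := Real.pi_gt_d2
  have hpi2 := Real.pi_lt_d2
  have key : ∀ z : ℝ, 1 / 10 ≤ z → z ≤ Real.pi / 2 → 3 / 50 ≤ Real.sin z := fun z hz hz2 => by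
    refine le_trans ?_ (Real.mul_le_sin (by linarith) hz2)
    rw [div_mul_eq_mul_div, le_div_iff₀ Real.pi_pos]
    linarith
  rcases le_total y (Real.pi / 2) with h | h
  · exact key y h1 h
  · rw [← Real.sin_pi_sub]
    exact key _ (by linarith) (by linarith)

/-- The stretched interval has length between `π / 6` and `π / 2`, by the factor `3` lost in
`turns`, up to a rounding error of `h - l ≤ 1 / 40`. In particular the coin costs `O(1 / (h - l))`.
-/
theorem coin_mul_mem (hl : 0 ≤ l) (hlh : l < h) (hh : h ≤ 1 / 40) :
    0.49 ≤ (2 * coin l h + 1) * (h - l) ∧ (2 * coin l h + 1) * (h - l) ≤ 1.65 := by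
  obtain ⟨h1, h2⟩ := abs_le.1 (abs_coin_sub_le hl hlh)
  have h4 := lt_turns hlh
  have h5 := turns_le hl hlh
  have hs : 0 < l + h := by linarith
  have hpi := Real.pi_gt_d2
  have hpi2 := Real.pi_lt_d2
  have hd : 0 < h - l := by linarith
  constructor
  · have h6 : (l + h) * 0.49 ≤ (l + h) * ((2 * coin l h + 1) * (h - l)) := by
      have h7 := mul_le_mul_of_nonneg_right h1 hd.le
      have h8 := mul_le_mul_of_nonneg_right h4 Real.pi_pos.le
      nlinarith
    exact le_of_mul_le_mul_left h6 hs
  · have h6 : (l + h) * ((2 * coin l h + 1) * (h - l)) ≤ (l + h) * 1.65 := by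
      have h7 := mul_le_mul_of_nonneg_right h2 hd.le
      have h8 := mul_le_mul_of_nonneg_right h5 Real.pi_pos.le
      nlinarith
    exact le_of_mul_le_mul_left h6 hs

theorem coin_mul_le (hl : 0 ≤ l) (hlh : l < h) (hh : h ≤ 1 / 40) :
    (2 * coin l h + 1) * (h - l) ≤ 2 := by
  linarith [(coin_mul_mem hl hlh hh).2]

/-- In the upper third `θ` exceeds the midpoint by at least `(h - l) / 6`. The doubled offset is at
least `2 * (0.49 / 6 - 1 / 40) > 1 / 10` and at most `2 * (1.65 / 2 + 1 / 40) < 2`. -/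
theorem le_sin_offset_upper {θ : ℝ} (hl : 0 ≤ l) (hlh : l < h) (hh : h ≤ 1 / 40) (hθ : θ ≤ h)
    (hu : (l + 2 * h) / 3 ≤ θ) :
    3 / 50 ≤ Real.sin (2 * ((2 * coin l h + 1) * θ - (2 * turns l h + 1) * Real.pi / 4)) := by
  obtain ⟨h1, h2⟩ := abs_le.1 (abs_coin_sub_le hl hlh)
  obtain ⟨h3, h4⟩ := coin_mul_mem hl hlh hh
  have hn : (0 : ℝ) ≤ 2 * coin l h + 1 := by positivity
  have ha := mul_le_mul_of_nonneg_left hu hn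
  have hb := mul_le_mul_of_nonneg_left hθ hn
  exact le_sin_of_mem (by linarith) (by linarith)

theorem sin_offset_lower_le {θ : ℝ} (hl : 0 ≤ l) (hlh : l < h) (hh : h ≤ 1 / 40) (hθ : l ≤ θ)
    (hu : θ ≤ (2 * l + h) / 3) :
    Real.sin (2 * ((2 * coin l h + 1) * θ - (2 * turns l h + 1) * Real.pi / 4)) ≤ -(3 / 50) := by
  obtain ⟨h1, h2⟩ := abs_le.1 (abs_coin_sub_le hl hlh)
  obtain ⟨h3, h4⟩ := coin_mul_mem hl hlh hh
  have hn : (0 : ℝ) ≤ 2 * coin l h + 1 := by positivity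
  have ha := mul_le_mul_of_nonneg_left hu hn
  have hb := mul_le_mul_of_nonneg_left hθ hn
  rw [le_neg, ← Real.sin_neg]
  exact le_sin_of_mem (by linarith) (by linarith)

end Angles

end CoinTree

end QuantumTrace

/-! ### Error of a single bisection step -/

namespace QuantumTrace

namespace CoinTree

/-- In an outer third the bias is at least `3 / 100` in the direction given by the parity, and `4 *
0.53 * 0.47 = 0.9964 < 399 / 400`. In the middle third both continuations are valid, so the vote may
be arbitrary. -/
theorem le_success_bisect {θ : ℝ} {F : ℝ → ℕ → Prop} {l h V : ℝ} (hl : 0 ≤ l) (hlh : l < h)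
    (hh : h ≤ 1 / 40) (hlθ : l ≤ θ) (hθh : θ ≤ h) (hV : V ≤ 1) (R c : ℕ) (next : Bool → CoinTree)
    (hup : (2 * l + h) / 3 ≤ θ → V ≤ (next true).success
      (fun k => Real.sin ((2 * k + 1) * θ) ^ 2) F (c + 2 * R * (2 * coin l h + 1)))
    (hlow : θ ≤ (l + 2 * h) / 3 → V ≤ (next false).success
      (fun k => Real.sin ((2 * k + 1) * θ) ^ 2) F (c + 2 * R * (2 * coin l h + 1))) :
    V - (399 / 400) ^ R ≤ (bisect l h R next).success
      (fun k => Real.sin ((2 * k + 1) * θ) ^ 2) F c := by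
  have hp : ∀ k : ℕ, 0 ≤ Real.sin ((2 * k + 1) * θ) ^ 2 ∧ Real.sin ((2 * k + 1) * θ) ^ 2 ≤ 1 :=
    fun k => ⟨sq_nonneg _, Real.sin_sq_le_one _⟩
  have hpow : (4 * (53 / 100 : ℝ) * (1 - 53 / 100)) ^ R ≤ (399 / 400) ^ R :=
    pow_le_pow_left₀ (by norm_num) (by norm_num) R
  have hpow' : (4 * (47 / 100 : ℝ) * (1 - 47 / 100)) ^ R ≤ (399 / 400) ^ R :=
    pow_le_pow_left₀ (by norm_num) (by norm_num) R
  have hsq := sin_sq_coin (l := l) (h := h) θ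
  have hdec : ∀ j, R ≤ j → decide (R ≤ j) = true := fun j hj => decide_eq_true hj
  have hdec' : ∀ j, j < R → decide (R ≤ j) = false := fun j hj => decide_eq_false (not_le.2 hj)
  rcases lt_or_ge θ ((2 * l + h) / 3) with h1 | h1
  · have hs := sin_offset_lower_le hl hlh hh hlθ h1.le
    have hV2 := hlow (by linarith)
    rcases Nat.even_or_odd (turns l h) with he | ho
    · rw [he.neg_one_pow, one_mul] at hsq
      refine le_trans (by linarith) (le_success_vote_of_le hp _ _ R c hV (p₀ := 47 / 100)
        (by norm_num) (by norm_num) (by linarith) fun j hj => ?_)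
      simpa [hdec' j hj, he] using hV2
    · rw [ho.neg_one_pow] at hsq
      refine le_trans (by linarith) (le_success_vote_of_ge hp _ _ R c hV (p₀ := 53 / 100)
        (by norm_num) (by norm_num) (by linarith) fun j hj => ?_)
      simpa [hdec j hj, Nat.not_even_iff_odd.2 ho] using hV2
  · rcases lt_or_ge ((l + 2 * h) / 3) θ with h2 | h2
    · have hs := le_sin_offset_upper hl hlh hh hθh h2.le
      have hV2 := hup h1
      rcases Nat.even_or_odd (turns l h) with he | ho
      · rw [he.neg_one_pow, one_mul] at hsq
        refine le_trans (by linarith) (le_success_vote_of_ge hp _ _ R c hV (p₀ := 53 / 100)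
          (by norm_num) (by norm_num) (by linarith) fun j hj => ?_)
        simpa [hdec j hj, he] using hV2
      · rw [ho.neg_one_pow] at hsq
        refine le_trans (by linarith) (le_success_vote_of_le hp _ _ R c hV (p₀ := 47 / 100)
          (by norm_num) (by norm_num) (by linarith) fun j hj => ?_)
        simpa [hdec' j hj, Nat.not_even_iff_odd.2 ho] using hV2
    · have hnext : ∀ b, V ≤ (next b).success
          (fun k => Real.sin ((2 * k + 1) * θ) ^ 2) F (c + 2 * R * (2 * coin l h + 1)) := by
        intro b; cases b
        exacts [hlow h2, hup h1]
      refine le_trans ?_ (le_success_vote_of_forall hp _ _ _ _ _ fun j => hnext _)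
      have : (0 : ℝ) ≤ (399 / 400) ^ R := by positivity
      linarith

/-- If the angle is small compared to the interval, then the error is small, too. -/
theorem le_success_bisect_of_small {θ : ℝ} {F : ℝ → ℕ → Prop} {h V : ℝ} (hh0 : 0 < h)
    (hh : h ≤ 1 / 40) (hθ : 0 < θ) (hθh : θ ≤ h / 3) (hV : V ≤ 1) {R : ℕ} (hR : 1 ≤ R) (c : ℕ)
    (next : Bool → CoinTree)
    (hlow : V ≤ (next false).success
      (fun k => Real.sin ((2 * k + 1) * θ) ^ 2) F (c + 2 * R * (2 * coin 0 h + 1))) :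
    V - (399 / 400) ^ R * (3 * (θ / h)) ≤ (bisect 0 h R next).success
      (fun k => Real.sin ((2 * k + 1) * θ) ^ 2) F c := by
  have hp : ∀ k : ℕ, 0 ≤ Real.sin ((2 * k + 1) * θ) ^ 2 ∧ Real.sin ((2 * k + 1) * θ) ^ 2 ≤ 1 :=
    fun k => ⟨sq_nonneg _, Real.sin_sq_le_one _⟩
  have ht : turns 0 h = 0 := by
    simp [turns, hh0.ne']
  set x := θ / h with hx
  have hx0 : 0 < x := div_pos hθ hh0
  have hx1 : x ≤ 1 / 3 := by rw [hx, div_le_iff₀ hh0]; linarith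
  have hθx : θ = x * h := by rw [hx]; field_simp
  -- The exact bound is `π / 2 + h`; it makes the heads probability quadratic in `x = θ / h`.
  have hc : (2 * coin 0 h + 1) * h ≤ 1.6 := by
    have h1 : (coin 0 h : ℝ) ≤ (2 * turns 0 h + 1) * Real.pi / (4 * (0 + h)) :=
      Nat.floor_le (by positivity)
    rw [ht, le_div_iff₀ (by positivity)] at h1
    have := Real.pi_lt_d2
    push_cast at h1
    nlinarith
  have hsin : Real.sin ((2 * coin 0 h + 1) * θ) ^ 2 ≤ 2.56 * x ^ 2 := by
    have h1 : 0 ≤ (2 * coin 0 h + 1) * θ := by positivity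
    have h2 : |Real.sin ((2 * coin 0 h + 1) * θ)| ≤ 1.6 * x := by
      refine Real.abs_sin_le_abs.trans ?_
      rw [abs_of_nonneg h1, hθx]
      nlinarith
    calc Real.sin ((2 * coin 0 h + 1) * θ) ^ 2 = |Real.sin ((2 * coin 0 h + 1) * θ)| ^ 2 :=
          (sq_abs _).symm
      _ ≤ (1.6 * x) ^ 2 := pow_le_pow_left₀ (abs_nonneg _) h2 2
      _ = 2.56 * x ^ 2 := by ring
  have hx2 : x ^ 2 ≤ 1 / 9 := by nlinarith
  have hb : 4 * (2.56 * x ^ 2) * (1 - 2.56 * x ^ 2) ≤ 399 / 400 * (3 * x) := by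
    have h3 : x * (1 - 2.56 * x ^ 2) ≤ 1 / 3 * (1 - 2.56 / 9) := by
      nlinarith [mul_nonneg (sub_nonneg.2 hx1) (by nlinarith : 0 ≤ 1 - 2.56 * (1 / 9 + x / 3 + x ^ 2))]
    nlinarith
  have hb0 : 0 ≤ 4 * (2.56 * x ^ 2) * (1 - 2.56 * x ^ 2) :=
    mul_nonneg (by positivity) (by linarith)
  -- One factor `3 * x` of `(3 * x) ^ R` is kept; it makes the errors over all intervals `[0, h]` a
  -- geometric series.
  have hpow : (4 * (2.56 * x ^ 2) * (1 - 2.56 * x ^ 2)) ^ R ≤ (399 / 400) ^ R * (3 * x) := by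
    refine (pow_le_pow_left₀ hb0 hb R).trans ?_
    rw [mul_pow]
    refine mul_le_mul_of_nonneg_left ?_ (by positivity)
    exact pow_le_of_le_one (by positivity) (by linarith) (by omega)
  refine le_trans (by linarith) (le_success_vote_of_le hp _ _ R c hV (p₀ := 2.56 * x ^ 2)
    (by positivity) (by linarith) hsin fun j hj => ?_)
  simpa [decide_eq_false (not_le.2 hj), ht] using hlow

end CoinTree

end QuantumTrace

/-! ### The adaptive search: total error and cost -/

namespace QuantumTrace

namespace CoinTree

/-- Shrink the interval `[l, h]` by the factor `(2 / 3) ^ r`, and output the value of `est` at its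
lower end. -/
noncomputable def narrow (est : ℝ → ℝ) (R : ℕ) : ℕ → ℝ → ℝ → CoinTree
  | 0, l, _ => out (est l)
  | r + 1, l, h => bisect l h (R * (r + 1)) fun b =>
      if b then narrow est R r ((2 * l + h) / 3) h else narrow est R r l ((l + 2 * h) / 3)

/-- Shrink the interval `[0, h]` until the angle is known up to a constant factor, then narrow it. -/
noncomputable def search (est : ℝ → ℝ) (R J : ℕ) : ℕ → ℝ → CoinTree
  | 0, _ => out 0
  | f + 1, h => bisect 0 h R fun b =>
      if b then narrow est R J (h / 3) h else search est R J f (2 * h / 3)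

variable {θ : ℝ} {F : ℝ → ℕ → Prop} {est : ℝ → ℝ} {R : ℕ} {B : ℝ}

/-- With `i` rounds to go the interval has length `W * (3 / 2) ^ i`, a coin costs at most `2 * (2 /
3) ^ i / W`, and `2 * R * i` coins are used. The cost bound follows from `∑ i ∈ [1, r], i * (2 / 3)
^ i = 6 - (2 * r + 6) * (2 / 3) ^ r`. For `D = (399 / 400) ^ R ≤ 1 / 2` the errors `D ^ i` sum to at
most `2 * D * (1 - D ^ r)`. -/
theorem le_success_narrow {W : ℝ} (hW : 0 < W) (hD : (399 / 400 : ℝ) ^ R ≤ 1 / 2)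
    (hF : ∀ (l : ℝ) (c : ℕ), 0 ≤ l → l ≤ θ → θ ≤ l + W → (c : ℝ) ≤ B → F (est l) c)
    (r : ℕ) {l h : ℝ} (hl : 0 ≤ l) (hh : h ≤ 1 / 40) (hlθ : l ≤ θ) (hθh : θ ≤ h)
    (hw : h - l = W * (3 / 2) ^ r) (c : ℕ)
    (hc : c + 4 * R / W * (6 - (2 * r + 6) * (2 / 3) ^ r) ≤ B) :
    1 - 2 * (399 / 400 : ℝ) ^ R * (1 - ((399 / 400 : ℝ) ^ R) ^ r) ≤
      (narrow est R r l h).success (fun k => Real.sin ((2 * k + 1) * θ) ^ 2) F c := by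
  induction r generalizing l h c with
  | zero =>
    have h1 : F (est l) c := hF l c hl hlθ (by rw [pow_zero] at hw; linarith)
      (by norm_num at hc; exact hc)
    simp [narrow, success, h1]
  | succ r ih =>
    set D : ℝ := (399 / 400 : ℝ) ^ R with hDdef
    have hD0 : 0 < D := by positivity
    have hlh : l < h := by
      have : 0 < W * (3 / 2) ^ (r + 1) := by positivity
      linarith
    have hDr : D ^ r ≤ 1 := pow_le_one₀ hD0.le (by linarith)
    have hV : 1 - 2 * D * (1 - D ^ r) ≤ 1 := by
      have := mul_nonneg hD0.le (sub_nonneg.2 hDr)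
      linarith
    have hcoin := coin_mul_le hl hlh hh
    have hcost : ((c + 2 * (R * (r + 1)) * (2 * coin l h + 1) : ℕ) : ℝ) +
        4 * R / W * (6 - (2 * r + 6) * (2 / 3) ^ r) ≤ B := by
      refine le_trans ?_ hc
      have h1 : (2 * coin l h + 1 : ℝ) ≤ 2 * (2 / 3) ^ (r + 1) / W := by
        rw [hw] at hcoin
        have h2 : (3 / 2 : ℝ) ^ (r + 1) * (2 / 3) ^ (r + 1) = 1 := by
          rw [← mul_pow]; norm_num
        rw [le_div_iff₀ hW]
        have h3 := mul_le_mul_of_nonneg_right hcoin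
          (by positivity : (0 : ℝ) ≤ (2 / 3) ^ (r + 1))
        calc (2 * coin l h + 1 : ℝ) * W = (2 * coin l h + 1 : ℝ) * W *
            ((3 / 2) ^ (r + 1) * (2 / 3) ^ (r + 1)) := by rw [h2, mul_one]
          _ = (2 * coin l h + 1) * (W * (3 / 2) ^ (r + 1)) * (2 / 3) ^ (r + 1) := by ring
          _ ≤ _ := h3
      have h4 : (2 * (R * (r + 1)) : ℝ) * (2 * coin l h + 1) ≤
          2 * (R * (r + 1)) * (2 * (2 / 3) ^ (r + 1) / W) :=
        mul_le_mul_of_nonneg_left h1 (by positivity)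
      push_cast
      have h5 : (2 * (R * (r + 1)) : ℝ) * (2 * (2 / 3) ^ (r + 1) / W) +
          4 * R / W * (6 - (2 * r + 6) * (2 / 3) ^ r) =
          4 * R / W * (6 - (2 * (r + 1) + 6) * (2 / 3) ^ (r + 1)) := by
        rw [pow_succ]; field_simp; ring
      linarith
    have hpow : (399 / 400 : ℝ) ^ (R * (r + 1)) = D ^ (r + 1) := pow_mul _ _ _
    have hstep : 1 - 2 * D * (1 - D ^ (r + 1)) ≤
        1 - 2 * D * (1 - D ^ r) - (399 / 400 : ℝ) ^ (R * (r + 1)) := by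
      rw [hpow, pow_succ]
      have h1 : D * (D ^ r * D) ≤ 1 / 2 * (D ^ r * D) :=
        mul_le_mul_of_nonneg_right hD (by positivity)
      linarith
    refine hstep.trans (le_success_bisect hl hlh hh hlθ hθh hV _ _ _ (fun h1 => ?_) fun h1 => ?_)
    · simp only [if_true]
      refine ih (by linarith) hh h1 hθh ?_ _ hcost
      rw [pow_succ] at hw
      linarith
    · simp only [Bool.false_eq_true, if_false]
      refine ih hl (by linarith) hlθ h1 ?_ _ hcost
      rw [pow_succ] at hw
      linarith

/-- Both bounds are potentials in `h`. Passing from `h` to `2 * h / 3` raises `8 / h` to `12 / h`,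
which pays the cost `4 * R / h` of the step, and raises `6 * (θ / h)` to `9 * (θ / h)`, which pays
its error `3 * D * (θ / h)`. -/
theorem le_success_search {η : ℝ} {J : ℕ} (hR : 1 ≤ R) (hD : (399 / 400 : ℝ) ^ R ≤ 1 / 2)
    (hJ : 2 * (2 / 3 : ℝ) ^ J ≤ η) (hθ : 0 < θ)
    (hF : ∀ (l : ℝ) (c : ℕ), 0 ≤ l → l ≤ θ → θ ≤ l + η * θ → (c : ℝ) ≤ B → F (est l) c)
    (f : ℕ) {h : ℝ} (hh : h ≤ 1 / 40) (hθh : θ ≤ h) (hf : h * (2 / 3) ^ f < θ) (c : ℕ)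
    (hc : c + R * ((36 * (3 / 2) ^ J + 12) / θ - 8 / h) ≤ B) :
    1 - (399 / 400 : ℝ) ^ R * (9 - 6 * (θ / h)) ≤
      (search est R J f h).success (fun k => Real.sin ((2 * k + 1) * θ) ^ 2) F c := by
  induction f generalizing h c with
  -- With no rounds left `hf` says `h < θ`, so the dummy output of `search` is irrelevant.
  | zero => rw [pow_zero, mul_one] at hf; linarith
  | succ f ih =>
    set D : ℝ := (399 / 400 : ℝ) ^ R with hDdef
    have hD0 : 0 < D := by positivity
    have hh0 : 0 < h := hθ.trans_le hθh
    have hcoin := coin_mul_le le_rfl hh0 hh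
    have hx0 : 0 < θ / h := div_pos hθ hh0
    have hx1 : θ / h ≤ 1 := (div_le_one hh0).2 hθh
    have hstepcost : ((c + 2 * R * (2 * coin 0 h + 1) : ℕ) : ℝ) ≤ c + R * (4 / h) := by
      rw [sub_zero, ← le_div_iff₀ hh0] at hcoin
      have h1 : (2 * R : ℝ) * (2 * coin 0 h + 1) ≤ 2 * R * (2 / h) :=
        mul_le_mul_of_nonneg_left hcoin (by positivity)
      push_cast
      have h2 : (2 * R : ℝ) * (2 / h) = R * (4 / h) := by ring
      linarith
    have hlow : θ ≤ 2 * h / 3 → 1 - D * (9 - 9 * (θ / h)) ≤ (search est R J f (2 * h / 3)).success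
        (fun k => Real.sin ((2 * k + 1) * θ) ^ 2) F (c + 2 * R * (2 * coin 0 h + 1)) := by
      intro h1
      have h2 := ih (h := 2 * h / 3) (by linarith) h1
        (by rw [pow_succ] at hf; linarith) (c + 2 * R * (2 * coin 0 h + 1)) (by
          have h3 : (8 : ℝ) / (2 * h / 3) = 12 / h := by field_simp; norm_num
          rw [h3]
          refine le_trans ?_ hc
          have h4 : (R : ℝ) * (4 / h) + R * ((36 * (3 / 2) ^ J + 12) / θ - 12 / h) =
            R * ((36 * (3 / 2) ^ J + 12) / θ - 8 / h) := by ring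
          linarith)
      have h3 : 6 * (θ / (2 * h / 3)) = 9 * (θ / h) := by field_simp; norm_num
      rwa [h3] at h2
    have hup : h / 3 ≤ θ → 1 - 2 * D ≤ (narrow est R J (h / 3) h).success
        (fun k => Real.sin ((2 * k + 1) * θ) ^ 2) F (c + 2 * R * (2 * coin 0 h + 1)) := by
      intro h1
      have hJ0 : (0 : ℝ) < (2 / 3) ^ J := by positivity
      have hJJ : (2 / 3 : ℝ) ^ J * (3 / 2) ^ J = 1 := by rw [← mul_pow]; norm_num
      have hJ32 : (3 / 2 : ℝ) ^ J = 1 / (2 / 3) ^ J := by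
        rw [eq_div_iff hJ0.ne', mul_comm]; exact hJJ
      -- The interval `[h / 3, h]` has length `2 * h / 3 ≤ 2 * θ`, so `J` rounds bring it below `η *
      -- θ`.
      have h2 := le_success_narrow (F := F) (est := est) (θ := θ) (B := B) (R := R)
        (W := 2 * h / 3 * (2 / 3) ^ J) (by positivity) hD
        (fun l c hl0 hl hl' hc' => hF l c hl0 hl (hl'.trans (by
          have h3 : 2 * h / 3 * (2 / 3) ^ J ≤ 2 * θ * (2 / 3) ^ J :=
            mul_le_mul_of_nonneg_right (by linarith) hJ0.le
          have h4 := mul_le_mul_of_nonneg_right hJ hθ.le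
          linarith)) hc') J
        (l := h / 3) (h := h) (by linarith) hh h1 hθh
        (by rw [mul_assoc, hJJ]; ring) (c + 2 * R * (2 * coin 0 h + 1)) (by
          refine le_trans ?_ hc
          have h3 : 4 * R / (2 * h / 3 * (2 / 3) ^ J) * (6 - (2 * J + 6) * (2 / 3) ^ J) ≤
              R * (36 * (3 / 2) ^ J / h) := by
            have h4 : 4 * R / (2 * h / 3 * (2 / 3) ^ J) * 6 = R * (36 * (3 / 2) ^ J / h) := by
              rw [hJ32]; field_simp; ring
            rw [← h4]
            refine mul_le_mul_of_nonneg_left ?_ (by positivity)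
            have : 0 ≤ (2 * (J : ℝ) + 6) * (2 / 3) ^ J := by positivity
            linarith
          have h5 : (36 * (3 / 2) ^ J + 12 : ℝ) / h ≤ (36 * (3 / 2) ^ J + 12) / θ :=
            div_le_div_of_nonneg_left (by positivity) hθ hθh
          have h6 := mul_le_mul_of_nonneg_left h5 (Nat.cast_nonneg (α := ℝ) R)
          have h7 : (R : ℝ) * (4 / h) + R * (36 * (3 / 2) ^ J / h) =
              R * ((36 * (3 / 2) ^ J + 12) / h) - R * (8 / h) := by ring
          rw [mul_sub]
          linarith)
      have h3 : 0 ≤ D * D ^ J := by positivity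
      exact le_trans (by linarith) h2
    -- For `θ ≤ h / 3` the refined error is needed. Otherwise the plain error `D` is affordable,
    -- because `8 - 6 * (θ / h)` is at least `9 - 9 * (θ / h)` and at least `2`.
    rcases le_or_gt (θ / h) (1 / 3) with hx | hx
    · have h1 : θ ≤ h / 3 := by rw [div_le_iff₀ hh0] at hx; linarith
      have h2 : 0 ≤ D * (9 - 9 * (θ / h)) := mul_nonneg hD0.le (by linarith)
      refine le_trans (le_of_eq ?_) (le_success_bisect_of_small hh0 hh hθ h1
        (V := 1 - D * (9 - 9 * (θ / h))) (by linarith) hR c _ ?_)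
      · ring
      · simpa only [Bool.false_eq_true, if_false] using hlow (by linarith)
    · have h2 : 0 ≤ D * (8 - 6 * (θ / h)) := mul_nonneg hD0.le (by linarith)
      refine le_trans (le_of_eq ?_) (le_success_bisect le_rfl hh0 hh hθ.le hθh
        (V := 1 - D * (8 - 6 * (θ / h))) (by linarith) R c _ (fun h1 => ?_) fun h1 => ?_)
      · ring
      · simp only [if_true]
        refine le_trans ?_ (hup (by linarith))
        have : D * (θ / h) ≤ D * 1 := mul_le_mul_of_nonneg_left hx1 hD0.le
        linarith
      · simp only [Bool.false_eq_true, if_false]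
        refine le_trans ?_ (hlow (by linarith))
        have : D * (1 / 3) ≤ D * (θ / h) := mul_le_mul_of_nonneg_left hx.le hD0.le
        linarith

end CoinTree

end QuantumTrace

/-! ### From coins to quantum programs -/

namespace QuantumTrace

/-- Adaptive coin flips estimate `τ * sin θ ^ 2` up to the relative error `ε`. -/
theorem exists_coinTree {ε δ θ₀ : ℝ} (τ : ℝ) (hε : 0 < ε) (hε1 : ε < 1) (hδ : 0 < δ) (hδ1 : δ < 1)
    (hθ₀ : 0 < θ₀) (hτ : 0 < τ) : ∃ t : CoinTree, ∀ (θ : ℝ) (F : ℝ → ℕ → Prop),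
      θ₀ ≤ θ → θ ≤ 1 / 40 →
      (∀ (I : ℝ) (c : ℕ), |I - τ * Real.sin θ ^ 2| ≤ ε * (τ * Real.sin θ ^ 2) →
        (c : ℝ) ≤ 2000000 * max 1 (Real.log (1 / δ)) / (ε * θ) → F I c) →
      1 - δ ≤ t.success (fun k => Real.sin ((2 * k + 1) * θ) ^ 2) F 0 := by
  -- `J + 1` rounds give relative width at most `ε / 5`, and minimality keeps `(3 / 2) ^ (J + 1)`
  -- below `15 / ε`.
  obtain ⟨J, hJ1, hJ2⟩ := exists_nat_pow_near_of_lt_one (show 0 < ε / 10 by positivity)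
    (show ε / 10 ≤ 1 by linarith) (show (0 : ℝ) < 2 / 3 by norm_num) (by norm_num)
  -- The lower bound `θ₀` only makes the tree finite; it does not enter the cost.
  obtain ⟨f, hf⟩ := exists_pow_lt_of_lt_one hθ₀ (show (2 / 3 : ℝ) < 1 by norm_num)
  -- Chosen so that the total error `9 * (399 / 400) ^ R` is at most `δ`.
  set R := ⌈400 * Real.log (9 / δ)⌉₊ with hRdef
  have hlog : 0 < Real.log (9 / δ) := Real.log_pos (by rw [lt_div_iff₀ hδ]; linarith)
  have hR1 : 1 ≤ R := Nat.one_le_ceil_iff.2 (by positivity)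
  have hRle : (R : ℝ) ≤ 3601 * max 1 (Real.log (1 / δ)) := by
    have h1 : (R : ℝ) < 400 * Real.log (9 / δ) + 1 := Nat.ceil_lt_add_one (by positivity)
    have h2 : Real.log (9 / δ) = Real.log 9 + Real.log (1 / δ) := by
      rw [← Real.log_mul (by norm_num) (by positivity)]
      congr 1; ring
    have h3 : Real.log 9 ≤ 9 - 1 := Real.log_le_sub_one_of_pos (by norm_num)
    have h4 := le_max_left 1 (Real.log (1 / δ))
    have h5 := le_max_right 1 (Real.log (1 / δ))
    linarith
  have hD : (399 / 400 : ℝ) ^ R ≤ δ / 9 := by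
    have h1 : (399 / 400 : ℝ) ≤ Real.exp (-(1 / 400)) := by
      have := Real.add_one_le_exp (-(1 / 400 : ℝ))
      linarith
    have h2 : 400 * Real.log (9 / δ) ≤ R := Nat.le_ceil _
    calc (399 / 400 : ℝ) ^ R ≤ Real.exp (-(1 / 400)) ^ R := pow_le_pow_left₀ (by norm_num) h1 R
      _ = Real.exp (R * -(1 / 400)) := (Real.exp_nat_mul _ _).symm
      _ ≤ Real.exp (-Real.log (9 / δ)) := Real.exp_le_exp.2 (by linarith)
      _ = δ / 9 := by rw [Real.exp_neg, Real.exp_log (by positivity), inv_div]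
  refine ⟨CoinTree.search (fun l => τ * Real.sin l ^ 2) R (J + 1) f (1 / 40),
    fun θ F hθ hθ1 hF => ?_⟩
  have hθ0 : 0 < θ := hθ₀.trans_le hθ
  have hM : 0 < max 1 (Real.log (1 / δ)) := lt_max_of_lt_left one_pos
  have hcost : (R : ℝ) * ((36 * (3 / 2) ^ (J + 1) + 12) / θ) ≤
      2000000 * max 1 (Real.log (1 / δ)) / (ε * θ) := by
    have h1 : (3 / 2 : ℝ) ^ (J + 1) ≤ 15 / ε := by
      have h2 : (3 / 2 : ℝ) ^ J * (2 / 3) ^ J = 1 := by rw [← mul_pow]; norm_num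
      have h3 := mul_le_mul_of_nonneg_left hJ2 (by positivity : (0 : ℝ) ≤ (3 / 2) ^ J)
      rw [le_div_iff₀ hε, pow_succ]
      linarith
    have h2 : (12 : ℝ) ≤ 12 / ε := by rw [le_div_iff₀ hε]; linarith
    have h3 : 36 * (3 / 2 : ℝ) ^ (J + 1) + 12 ≤ 552 / ε := by
      have : 36 * (15 / ε) + 12 / ε = 552 / ε := by ring
      linarith
    calc (R : ℝ) * ((36 * (3 / 2) ^ (J + 1) + 12) / θ)
        ≤ (3601 * max 1 (Real.log (1 / δ))) * (552 / ε / θ) := by gcongr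
      _ = 1987752 * max 1 (Real.log (1 / δ)) / (ε * θ) := by field_simp; norm_num
      _ ≤ _ := by gcongr; norm_num
  have hacc : ∀ l : ℝ, 0 ≤ l → l ≤ θ → θ ≤ l + ε / 5 * θ →
      |τ * Real.sin l ^ 2 - τ * Real.sin θ ^ 2| ≤ ε * (τ * Real.sin θ ^ 2) := by
    intro l hl hlθ hl2
    have h1 : τ * Real.sin l ^ 2 - τ * Real.sin θ ^ 2 =
        τ * (Real.sin (l + θ) * Real.sin (l - θ)) := by
      rw [Real.sin_add, Real.sin_sub]
      have h2 := Real.sin_sq_add_cos_sq l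
      have h3 := Real.sin_sq_add_cos_sq θ
      linear_combination τ * Real.sin θ ^ 2 * h2 - τ * Real.sin l ^ 2 * h3
    have h2 : |Real.sin (l + θ)| ≤ 2 * θ :=
      Real.abs_sin_le_abs.trans (by rw [abs_of_nonneg (by linarith)]; linarith)
    have h3 : |Real.sin (l - θ)| ≤ ε / 5 * θ :=
      Real.abs_sin_le_abs.trans (by rw [abs_of_nonpos (by linarith)]; linarith)
    -- By Jordan's inequality `sin θ ≥ (2 / π) * θ`, and `(2 / π) ^ 2 > 2 / 5`.
    have h4 : 2 * θ * (ε / 5 * θ) ≤ ε * Real.sin θ ^ 2 := by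
      have h5 : 0.634 * θ ≤ Real.sin θ := by
        refine le_trans ?_ (Real.mul_le_sin hθ0.le (by linarith [Real.pi_gt_three]))
        refine mul_le_mul_of_nonneg_right ?_ hθ0.le
        rw [le_div_iff₀ Real.pi_pos]
        linarith [Real.pi_lt_d2]
      have h6 : 2 / 5 * θ ^ 2 ≤ Real.sin θ ^ 2 := by nlinarith
      have h7 := mul_le_mul_of_nonneg_left h6 hε.le
      linarith
    rw [h1, abs_mul, abs_mul, abs_of_pos hτ]
    calc τ * (|Real.sin (l + θ)| * |Real.sin (l - θ)|) ≤ τ * (2 * θ * (ε / 5 * θ)) := by gcongr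
      _ ≤ τ * (ε * Real.sin θ ^ 2) := by gcongr
      _ = _ := by ring
  have h := CoinTree.le_success_search (θ := θ) (F := F) (est := fun l => τ * Real.sin l ^ 2)
    (R := R) (B := 2000000 * max 1 (Real.log (1 / δ)) / (ε * θ)) (η := ε / 5) (J := J + 1) hR1
    (hD.trans (by linarith)) (by linarith) hθ0
    (fun l c hl hlθ hl2 hc => hF _ _ (hacc l hl hlθ hl2) hc) f (h := 1 / 40) le_rfl hθ1
    (by linarith [pow_pos (show (0 : ℝ) < 2 / 3 by norm_num) f]) 0
    (le_trans (by
      have : (0 : ℝ) ≤ R * (8 / (1 / 40)) := by positivity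
      rw [mul_sub]; push_cast; linarith) hcost)
  refine le_trans ?_ h
  have h9 : (399 / 400 : ℝ) ^ R * (9 - 6 * (θ / (1 / 40))) ≤ (399 / 400 : ℝ) ^ R * 9 :=
    mul_le_mul_of_nonneg_left (by linarith [div_pos hθ0 (show (0 : ℝ) < 1 / 40 by norm_num)])
      (by positivity)
  linarith

variable {w n c₁ c₂ : ℕ}

namespace Layout

variable (ly : Layout w n c₁ c₂) (u v : Fin n → FixedPoint c₁ c₂) (s : ℝ) (p₀ : Fin c₁ ⊕ Fin c₂)

/-- The quantum program for an adaptive experiment, where coin `k` is the flag after `k` steps of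
amplitude amplification. -/
noncomputable def compile : CoinTree → Program w n c₁ c₂
  | .out I => .output I
  | .flip k next => ly.sample s p₀ k fun b => compile (next b)

/-- The coin cost `2 * k + 1` controls both resources: a sample takes exactly `4 * (2 * k + 1)`
queries and at most `(3 * m + 7) * (2 * k + 1)` gates, where `m = Nat.clog 2 n`. -/
theorem success_le_weightFrom_compile {θ : ℝ} (hs : Real.sin θ ≠ 0) (hc : Real.cos θ ≠ 0)
    (hw : ((ly.start u v s).project ly.flag true).weight = Real.sin θ ^ 2) (F : ℝ → ℕ → Prop)
    (E : ℝ → ℕ → ℕ → Prop)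
    (hE : ∀ I c g, F I c → g ≤ (3 * Nat.clog 2 n + 7) * c → E I (4 * c) g)
    (t : CoinTree) (c g : ℕ) (hg : g ≤ (3 * Nat.clog 2 n + 7) * c) :
    t.success (fun k => Real.sin ((2 * k + 1) * θ) ^ 2) F c ≤
      (ly.compile s p₀ t).weightFrom u v E (zeroState w) (4 * c) g := by
  induction t generalizing c g with
  | out I =>
    simp only [CoinTree.success, compile, Program.weightFrom, weight_zeroState]
    split_ifs with h1 h2
    · exact le_rfl
    · exact absurd (hE I c g h1 hg) h2
    · exact zero_le_one
    · exact le_rfl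
  | flip k next ih =>
    have hg' : g + (k * (4 * Nat.clog 2 n + 13) + 3 * Nat.clog 2 n + 6) ≤
        (3 * Nat.clog 2 n + 7) * (c + (2 * k + 1)) := by
      nlinarith
    have h : ∀ b, _ := fun b => ih b (c + (2 * k + 1)) _ hg'
    rw [compile, ly.weightFrom_sample u v s p₀ hs hc hw, ← mul_add]
    exact add_le_add (mul_le_mul_of_nonneg_left (h true) (sq_nonneg _))
      (mul_le_mul_of_nonneg_left (h false) (sub_nonneg.2 (Real.sin_sq_le_one _)))

end Layout

/-- `binaryValue` is a bijection onto the numbers below `2 ^ m`; those that name no entry contribute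
`0`. -/
theorem sum_binaryValue {m : ℕ} (hn : n ≤ 2 ^ m) (f : Fin n → ℝ) :
    ∑ r : Fin m → Bool, (if h : binaryValue r < n then f ⟨binaryValue r, h⟩ else 0) = ∑ j, f j := by
  let e : (Fin m → Bool) ≃ Fin (2 ^ m) :=
    (Equiv.arrowCongr (Equiv.refl _) finTwoEquiv.symm).trans finFunctionFinEquiv
  have he : ∀ r, (e r : ℕ) = binaryValue r := by
    intro r
    simp only [e, Equiv.trans_apply, finFunctionFinEquiv_apply, binaryValue]
    refine Finset.sum_congr rfl fun i _ => ?_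
    cases h : r i <;> simp [h, finTwoEquiv]
  have h1 : ∑ r : Fin m → Bool, (if h : binaryValue r < n then f ⟨binaryValue r, h⟩ else 0) =
      ∑ i : Fin (2 ^ m), (if h : (i : ℕ) < n then f ⟨i, h⟩ else 0) := by
    rw [← Equiv.sum_comp e]
    refine Finset.sum_congr rfl fun r _ => ?_
    simp only [he]
  rw [h1]
  symm
  refine Fintype.sum_of_injective (Fin.castLE hn) (Fin.castLE_injective hn) _ _ (fun i hi => ?_)
    fun j => ?_
  · rw [dif_neg]
    exact fun h => hi ⟨⟨i, h⟩, rfl⟩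
  · simp

theorem sum_entryValue_mul (u v : Fin n → FixedPoint c₁ c₂) :
    ∑ r, entryValue u r * entryValue v r =
      ∑ j, fixedPointValue (u j) * fixedPointValue (v j) := by
  rw [← sum_binaryValue (Nat.le_pow_clog one_lt_two n)]
  refine Finset.sum_congr rfl fun r _ => ?_
  unfold entryValue
  split_ifs <;> simp

theorem two_pow_clog_le (hn : 1 ≤ n) : 2 ^ Nat.clog 2 n ≤ 2 * n := by
  rcases hn.eq_or_lt with rfl | hn
  · simp
  · have h := Nat.pow_pred_clog_lt_self one_lt_two hn
    have h2 : 0 < Nat.clog 2 n := Nat.clog_pos one_lt_two hn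
    rw [← Nat.succ_pred_eq_of_pos h2, pow_succ]
    omega

theorem sum_stackColumns {N K : ℕ} {A B : Matrix (Fin N) (Fin K) ℝ}
    {a b : Matrix (Fin N) (Fin K) (FixedPoint c₁ c₂)} (ha : ∀ j k, fixedPointValue (a j k) = A j k)
    (hb : ∀ j k, fixedPointValue (b j k) = B j k) :
    ∑ r, fixedPointValue (stackColumns a r) * fixedPointValue (stackColumns b r) =
      (Aᵀ * B).trace := by
  rw [← Equiv.sum_comp finProdFinEquiv, Fintype.sum_prod_type]
  simp [stackColumns, Matrix.vec, Matrix.trace, Matrix.mul_apply, ha, hb]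

end QuantumTrace

/-! ### Choice of the scale and the final constants -/

namespace QuantumTrace

variable {n c₁ c₂ : ℕ}

/-- A program that estimates an inner product of two vectors of fixed-point numbers with known
largest product `z`. -/
theorem exists_program (n c₁ c₂ : ℕ) {z ε δ : ℝ} (hn : 1 ≤ n) (hp : Nonempty (Fin c₁ ⊕ Fin c₂))
    (hz : 0 < z) (hε : 0 < ε) (hε1 : ε < 1) (hδ : 0 < δ) (hδ1 : δ < 1) :
    ∃ (w : ℕ) (P : Program w n c₁ c₂), ∀ (u v : Fin n → FixedPoint c₁ c₂) (t : ℝ)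
      (E : ℝ → ℕ → ℕ → Prop),
      (∀ r, fixedPointValue (u r) * fixedPointValue (v r) ≤ z) →
      ∑ r, fixedPointValue (u r) * fixedPointValue (v r) = t → z ≤ t →
      (∀ (I : ℝ) (q g : ℕ), |I - t| ≤ ε * t →
        (q : ℝ) ≤ 2000000000 * (1 / ε * √(n * z / t) * max 1 (Real.log (1 / δ))) →
        (g : ℝ) ≤ 2000000000 * (1 / ε * √(n * z / t) * max 1 (Real.log (1 / δ))) *
          (1 + Real.log n) → E I q g) →
      1 - δ ≤ P.prob u v E := by
  obtain ⟨p₀⟩ := hp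
  obtain ⟨w, ⟨ly⟩⟩ := nonempty_layout n c₁ c₂
  set m := Nat.clog 2 n with hm
  have hN : (0 : ℝ) < 2 ^ m := by positivity
  -- As `z ≤ t`, the flag has probability at least `1 / (4096 * 2 ^ m)`, which gives `θ₀`; the
  -- factor `2 ^ m * z * 4096` turns that probability back into `t`.
  obtain ⟨tree, htree⟩ := exists_coinTree (ε := ε) (δ := δ) (θ₀ := √(1 / 4096 / 2 ^ m))
    (2 ^ m * z * 4096) hε hε1 hδ hδ1 (Real.sqrt_pos.2 (by positivity)) (by positivity)
  refine ⟨w, ly.compile (1 / 4096 / z) p₀ tree, fun u v t E hle ht hzt hE => ?_⟩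
  have ht0 : 0 < t := hz.trans_le hzt
  have hn0 : (0 : ℝ) < n := by exact_mod_cast hn
  have hNn : (2 : ℝ) ^ m ≤ 2 * n := by exact_mod_cast two_pow_clog_le hn
  have hnN : (n : ℝ) ≤ 2 ^ m := by exact_mod_cast Nat.le_pow_clog one_lt_two n
  have htN : t ≤ 2 ^ m * z := by
    rw [← ht]
    calc ∑ r, fixedPointValue (u r) * fixedPointValue (v r) ≤ ∑ _r : Fin n, z :=
          Finset.sum_le_sum fun r _ => hle r
      _ = n * z := by simp
      _ ≤ _ := by gcongr
  have hentry : ∀ r, 0 ≤ entryValue u r * entryValue v r ∧ entryValue u r * entryValue v r ≤ z := by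
    intro r
    unfold entryValue
    split_ifs
    · exact ⟨mul_nonneg (fixedPointValue_nonneg _) (fixedPointValue_nonneg _), hle _⟩
    · simp [hz.le]
  -- the angle
  set a := t / (2 ^ m * z) / 4096 with ha
  have ha0 : 0 < a := by positivity
  have ha1 : a ≤ (1 / 64) ^ 2 := by
    have : t / (2 ^ m * z) ≤ 1 := (div_le_one (by positivity)).2 htN
    rw [ha]; linarith
  -- The scale `4096 = 64 ^ 2` serves to make `θ ≤ (π / 2) / 64 < 1 / 40`.
  have hsqrt : √a ≤ 1 / 64 := Real.sqrt_le_iff.2 ⟨by norm_num, ha1⟩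
  set θ := Real.arcsin √a with hθ
  have hsin : Real.sin θ = √a := Real.sin_arcsin (by linarith [Real.sqrt_nonneg a]) (by linarith)
  have hsin2 : Real.sin θ ^ 2 = a := by rw [hsin, Real.sq_sqrt ha0.le]
  have hθ0 : 0 ≤ θ := Real.arcsin_nonneg.2 (Real.sqrt_nonneg a)
  have hsinpos : 0 < Real.sin θ := by rw [hsin]; exact Real.sqrt_pos.2 ha0
  have hsinθ : Real.sin θ ≤ θ := Real.sin_le hθ0
  have hθpos : 0 < θ := hsinpos.trans_le hsinθ
  have hθ40 : θ ≤ 1 / 40 := by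
    have h := Real.mul_le_sin hθ0 (Real.arcsin_le_pi_div_two _)
    rw [hsin, div_mul_eq_mul_div, div_le_iff₀ Real.pi_pos] at h
    have h2 := mul_le_mul_of_nonneg_right hsqrt Real.pi_pos.le
    linarith [Real.pi_lt_d2]
  have hcos : Real.cos θ ≠ 0 := (Real.cos_pos_of_mem_Ioo
    ⟨by linarith [Real.pi_gt_three], by linarith [Real.pi_gt_three]⟩).ne'
  have hflag : ((ly.start u v (1 / 4096 / z)).project ly.flag true).weight = Real.sin θ ^ 2 := by
    rw [ly.weight_project_start, hsin2, ← Finset.sum_div, ← Finset.mul_sum, sum_entryValue_mul,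
      ht, ha]
    · rw [hm]; field_simp
    · intro r
      refine ⟨mul_nonneg (by positivity) (hentry r).1, ?_⟩
      rw [div_mul_eq_mul_div, div_le_one hz]
      linarith [(hentry r).1, (hentry r).2]
  have hest : 2 ^ m * z * 4096 * Real.sin θ ^ 2 = t := by
    rw [hsin2, ha]; field_simp
  have hθlow : √(1 / 4096 / 2 ^ m) ≤ θ := by
    refine le_trans (Real.sqrt_le_sqrt ?_) (hsin ▸ hsinθ)
    have h1 : t / (2 ^ m * z) / 4096 = 1 / 4096 / 2 ^ m * (t / z) := by field_simp
    rw [ha, h1]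
    exact le_mul_of_one_le_right (by positivity) ((one_le_div hz).2 hzt)
  -- the cost
  set M := max 1 (Real.log (1 / δ)) with hM
  have hM0 : 0 < M := lt_max_of_lt_left one_pos
  -- `1 / θ ≤ 1 / sin θ`, and `2 ^ m ≤ 2 * n` leaves the factor `√8192 < 100`.
  have hinv : 1 / θ ≤ 100 * √(n * z / t) := by
    have h1 : 1 ≤ (100 * √(n * z / t)) * √a := by
      rw [mul_assoc, ← Real.sqrt_mul (by positivity)]
      have h2 : 1 / 8192 ≤ n * z / t * a := by
        have h3 : n * z / t * a = n / 2 ^ m / 4096 := by rw [ha]; field_simp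
        have h4 : 1 / 2 ≤ (n : ℝ) / 2 ^ m := by rw [le_div_iff₀ hN]; linarith
        rw [h3]; linarith
      have h5 : 1 / 100 ≤ √(n * z / t * a) := Real.le_sqrt_of_sq_le (by linarith)
      linarith
    rw [div_le_iff₀ hθpos]
    exact h1.trans (mul_le_mul_of_nonneg_left (hsin ▸ hsinθ) (by positivity))
  set T := 1 / ε * √(n * z / t) * M with hT
  have hT0 : 0 ≤ T := by positivity
  have hcost : 2000000 * M / (ε * θ) ≤ 200000000 * T := by
    have h1 : 2000000 * M / (ε * θ) = 2000000 * (1 / ε) * M * (1 / θ) := by field_simp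
    rw [h1, hT]
    calc 2000000 * (1 / ε) * M * (1 / θ) ≤ 2000000 * (1 / ε) * M * (100 * √(n * z / t)) := by
          gcongr
      _ = _ := by ring
  have hmlog : 3 * (m : ℝ) + 7 ≤ 10 * (1 + Real.log n) := by
    have h1 := Real.log_le_log hN hNn
    rw [Real.log_pow, Real.log_mul two_ne_zero hn0.ne'] at h1
    have h2 := Real.log_two_gt_d9
    have h3 : 0 ≤ Real.log n := Real.log_nonneg (by exact_mod_cast hn)
    nlinarith
  have h := htree θ (fun I c => |I - t| ≤ ε * t ∧ (c : ℝ) ≤ 200000000 * T) hθlow hθ40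
    (fun I c hI hc => ⟨by rwa [hest] at hI, hc.trans hcost⟩)
  refine h.trans (ly.success_le_weightFrom_compile u v _ p₀ hsinpos.ne' hcos hflag _ E
    (fun I c g hF hg => ?_) tree 0 0 (by simp))
  -- The constant `2 * 10 ^ 9` covers the `4` queries per unit of coin cost, and equals `10 * (2 *
  -- 10 ^ 8)` for the gates.
  refine hE I (4 * c) g hF.1 ?_ ?_
  · push_cast
    linarith [hF.2]
  · have h1 : (g : ℝ) ≤ (3 * m + 7) * c := by exact_mod_cast hg
    calc (g : ℝ) ≤ (3 * m + 7) * c := h1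
      _ ≤ (10 * (1 + Real.log n)) * (200000000 * T) := by
          gcongr
          exact hF.2
      _ = _ := by ring

end QuantumTrace

theorem mainTheorem5 :
    ∃ (C : ℝ) (d : ℕ), 0 < C ∧
      ∀ (N K c₁ c₂ : ℕ) (z ε δ : ℝ), 0 < ε → ε < 1 → 0 < δ → δ < 1 →
        ∃ (w : ℕ) (P : QuantumTrace.Program w (K * N) c₁ c₂),
          ∀ (A B : Matrix (Fin N) (Fin K) ℝ)
            (a b : Matrix (Fin N) (Fin K) (QuantumTrace.FixedPoint c₁ c₂)),
            (∀ j k, QuantumTrace.fixedPointValue (a j k) = A j k) →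
            (∀ j k, QuantumTrace.fixedPointValue (b j k) = B j k) →
            IsGreatest {y : ℝ | ∃ j k, y = A j k * B j k} z →
            1 - δ ≤ P.prob (QuantumTrace.stackColumns a) (QuantumTrace.stackColumns b)
              fun I q g =>
                |I - (Aᵀ * B).trace| ≤ ε * (Aᵀ * B).trace ∧
                (q : ℝ) ≤ C * QuantumTrace.traceCost N K z (Aᵀ * B).trace ε δ ∧
                (g : ℝ) ≤ C * QuantumTrace.traceCost N K z (Aᵀ * B).trace ε δ *
                  (1 + Real.log (N * K * (1 + QuantumTrace.traceCost N K z (Aᵀ * B).trace ε δ))) ^ d := by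
  open QuantumTrace in
  refine ⟨2000000000, 1, by norm_num, fun N K c₁ c₂ z ε δ hε hε1 hδ hδ1 => ?_⟩
  -- The algorithm needs an entry, a bit (for the registers of the zero test) and `z > 0`. Otherwise
  -- every admissible input has `z = 0` and trace `0`, and the output `0` without any step is exact.
  by_cases hcase : 1 ≤ K * N ∧ Nonempty (Fin c₁ ⊕ Fin c₂) ∧ 0 < z
  · obtain ⟨hn, hp, hz⟩ := hcase
    obtain ⟨w, P, hP⟩ := exists_program (K * N) c₁ c₂ hn hp hz hε hε1 hδ hδ1
    refine ⟨w, P, fun A B a b ha hb hgreat => ?_⟩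
    have hprod : ∀ r, fixedPointValue (stackColumns a r) * fixedPointValue (stackColumns b r) ≤ z :=
      fun r => hgreat.2 ⟨_, _, by rw [← ha, ← hb]; rfl⟩
    have htr := sum_stackColumns ha hb
    -- The maximum is one of the nonnegative summands of the trace.
    have hzt : z ≤ (Aᵀ * B).trace := by
      obtain ⟨j, k, hjk⟩ := hgreat.1
      rw [← htr, hjk, ← ha, ← hb]
      have h := Finset.single_le_sum
        (f := fun r => fixedPointValue (stackColumns a r) * fixedPointValue (stackColumns b r))
        (fun r _ => mul_nonneg (fixedPointValue_nonneg _) (fixedPointValue_nonneg _))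
        (Finset.mem_univ (finProdFinEquiv (k, j)))
      simpa [stackColumns, Matrix.vec] using h
    refine hP _ _ _ _ hprod htr hzt fun I q g hI hq hg => ?_
    have hcost : traceCost N K z (Aᵀ * B).trace ε δ =
        1 / ε * √((K * N : ℕ) * z / (Aᵀ * B).trace) * max 1 (Real.log (1 / δ)) := by
      rw [traceCost, Nat.cast_mul, mul_comm (K : ℝ)]
    rw [← hcost] at hq hg
    refine ⟨hI, hq, hg.trans ?_⟩
    have hT : 0 ≤ traceCost N K z (Aᵀ * B).trace ε δ := by rw [hcost]; positivity
    have hNK : (0 : ℝ) < (K * N : ℕ) := by exact_mod_cast hn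
    rw [pow_one]
    refine mul_le_mul_of_nonneg_left ?_ (by positivity)
    have hle : ((K * N : ℕ) : ℝ) ≤ N * K * (1 + traceCost N K z (Aᵀ * B).trace ε δ) := by
      rw [mul_comm (N : ℝ), ← Nat.cast_mul]
      exact le_mul_of_one_le_right hNK.le (by linarith)
    linarith [Real.log_le_log hNK hle]
  · refine ⟨0, .output 0, fun A B a b ha hb hgreat => ?_⟩
    have hz : z = 0 := by
      obtain ⟨j, k, hjk⟩ := hgreat.1
      have hz0 : 0 ≤ z := by
        rw [hjk, ← ha, ← hb]
        exact mul_nonneg (fixedPointValue_nonneg _) (fixedPointValue_nonneg _)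
      by_contra hne
      refine hcase ⟨Nat.mul_pos (Fin.pos k) (Fin.pos j), ?_, lt_of_le_of_ne hz0 (Ne.symm hne)⟩
      by_contra hemp
      rw [not_nonempty_iff] at hemp
      refine hne ?_
      rw [hjk, ← ha, show a j k = fun _ => false from funext fun p => hemp.elim p,
        fixedPointValue_false, zero_mul]
    subst hz
    have htr : (Aᵀ * B).trace = 0 := by
      rw [← sum_stackColumns ha hb]
      refine Finset.sum_eq_zero fun r _ => le_antisymm ?_
        (mul_nonneg (fixedPointValue_nonneg _) (fixedPointValue_nonneg _))
      exact hgreat.2 ⟨_, _, by rw [← ha, ← hb]; rfl⟩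
    -- Here the quotient in `traceCost` is `0 / 0 = 0`, so the budget is `0`, and it is met.
    simp [Program.prob, Program.weightFrom, weight_zeroState, htr, traceCost, hδ.le]
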